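/- Let $n\ge 1$ be an integer and $\beta>-1$ a real number. Let $\mathbb D$ be the open unit disc, $dA$ the normalized area measure on $\mathbb D$, $dA_\beta(z)=(\beta+1)(1-|z|^2)^\beta\,dA(z)$, and $dV_\beta(z)=dA_\beta(z_1)\cdots dA_\beta(z_n)$ on $\mathbb D^n$. Let $A^2_\beta(\mathbb D^n)$ be the space of holomorphic functions $F$ on $\mathbb D^n$ with $\|F\|^2=\int_{\mathbb D^n}|F|^2\,dV_\beta<\infty$. For a holomorphic map $\Phi:\mathbb D^n\to\mathbb D^n$, the composition operator $C_\Phi:F\mapsto F\circ\Phi$ is called bounded on $A^2_\beta(\mathbb D^n)$ if it maps $A^2_\beta(\mathbb D^n)$ into itself and there is a constant $C$ with $\|F\circ\Phi\|\le C\|F\|$ for all $F\in A^2_\beta(\mathbb D^n)$. For a holomorphic function $\varphi:\mathbb D^n\to\mathbb D$ put $\Phi(\varphi)=(\varphi,\ldots,\varphi,0):\mathbb D^n\to\mathbb D^n$ (with $n-1$ entries $\varphi$). 1. Let $f(z)=z_1\cdots z_n$. Then $C_{\Phi(f)}$ is bounded on $A^2_\beta(\mathbb D^n)$ if and only if $n\le\beta+3$.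 2. Let $g(z)=\alpha_1z_1^n+\cdots+\alpha_nz_n^n$, where $\alpha_1,\ldots,\alpha_n\in\mathbb C\setminus\{0\}$ and $\sum_{j=1}^n|\alpha_j|=1$. Then $C_{\Phi(g)}$ is bounded on $A^2_\beta(\mathbb D^n)$ if and only if $\frac n2\le\beta+\frac52$. -/

import Mathlib

open MeasureTheory
open scoped ENNReal NNReal

noncomputable section

/-- The open unit polydisc in `ℂⁿ`. -/
def polydisc (n : ℕ) : Set (Fin n → ℂ) := {z | ∀ j, ‖z j‖ < 1}

/-- The normalized area measure `dA` on the unit disc, as a measure on `ℂ` carried by the disc. -/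
def discArea : Measure ℂ :=
  ENNReal.ofReal (1 / Real.pi) • (volume : Measure ℂ).restrict (Metric.ball 0 1)

/-- The weighted measure `dA_β = (β + 1) (1 - |z|²)^β dA` on the unit disc. -/
def weightedDiscArea (β : ℝ) : Measure ℂ :=
  discArea.withDensity fun z => ENNReal.ofReal ((β + 1) * (1 - ‖z‖ ^ 2) ^ β)

/-- The product measure `dV_β(z) = dA_β(z₁) ⋯ dA_β(zₙ)`; it is carried by the polydisc. -/
def weightedVolume (n : ℕ) (β : ℝ) : Measure (Fin n → ℂ) :=
  Measure.pi fun _ => weightedDiscArea β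

/-- The norm of the weighted Bergman space, with value `∞` if `F` is not square integrable.
It depends only on the restriction of `F` to the polydisc. -/
def bergmanNorm (n : ℕ) (β : ℝ) (F : (Fin n → ℂ) → ℂ) : ℝ≥0∞ :=
  (∫⁻ z, ‖F z‖ₑ ^ 2 ∂(weightedVolume n β)) ^ (1 / 2 : ℝ)

/-- The weighted Bergman space `A²_β(𝔻ⁿ)`. Its elements are represented by functions on `ℂⁿ` whose
values off the polydisc are arbitrary and play no role. -/
def bergmanSpace (n : ℕ) (β : ℝ) : Set ((Fin n → ℂ) → ℂ) :=
  {F | DifferentiableOn ℂ F (polydisc n) ∧ bergmanNorm n β F < ∞}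

/-- For a holomorphic self-map `Φ` of the polydisc: the composition operator `C_Φ : F ↦ F ∘ Φ` maps
`A²_β(𝔻ⁿ)` into itself and is bounded. -/
def IsBoundedCompOp (n : ℕ) (β : ℝ) (Φ : (Fin n → ℂ) → (Fin n → ℂ)) : Prop :=
  ∃ C : ℝ≥0, ∀ F ∈ bergmanSpace n β,
    F ∘ Φ ∈ bergmanSpace n β ∧ bergmanNorm n β (F ∘ Φ) ≤ C * bergmanNorm n β F

/-- `Φ(φ) = (φ, …, φ, 0)`: the last coordinate is `0`, the other `n - 1` ones are `φ`. -/
def diagonalMap (n : ℕ) (φ : (Fin n → ℂ) → ℂ) : (Fin n → ℂ) → (Fin n → ℂ) :=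
  fun z j => if (j : ℕ) + 1 = n then 0 else φ z

/-- `f(z) = z₁ ⋯ zₙ`. -/
def prodFun (n : ℕ) : (Fin n → ℂ) → ℂ := fun z => ∏ j, z j

/-- `g(z) = α₁ z₁ⁿ + ⋯ + αₙ zₙⁿ`. -/
def powerSumFun (n : ℕ) (α : Fin n → ℂ) : (Fin n → ℂ) → ℂ := fun z => ∑ j, α j * z j ^ n

/-! The symbols above are holomorphic self-maps of the polydisc. -/

theorem diagonalMap_mapsTo {n : ℕ} {φ : (Fin n → ℂ) → ℂ}
    (h : Set.MapsTo φ (polydisc n) (Metric.ball 0 1)) :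
    Set.MapsTo (diagonalMap n φ) (polydisc n) (polydisc n) := by
  intro z hz j
  have := h hz
  simp only [Metric.mem_ball, dist_zero_right] at this
  unfold diagonalMap
  split_ifs <;> simp [this]

theorem diagonalMap_differentiableOn {n : ℕ} {φ : (Fin n → ℂ) → ℂ}
    (h : DifferentiableOn ℂ φ (polydisc n)) :
    DifferentiableOn ℂ (diagonalMap n φ) (polydisc n) := by
  refine differentiableOn_pi.2 fun j => ?_
  unfold diagonalMap
  split_ifs
  · exact differentiableOn_const _
  · exact h

theorem prodFun_mapsTo {n : ℕ} (hn : 1 ≤ n) :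
    Set.MapsTo (prodFun n) (polydisc n) (Metric.ball 0 1) := by
  intro z hz
  obtain ⟨m, rfl⟩ : ∃ m, n = m + 1 := ⟨n - 1, by omega⟩
  simp only [Metric.mem_ball, dist_zero_right, prodFun, Fin.prod_univ_succ, norm_mul, norm_prod]
  exact mul_lt_one_of_nonneg_of_lt_one_left (norm_nonneg _) (hz 0)
    (Finset.prod_le_one (fun _ _ => norm_nonneg _) fun j _ => (hz (Fin.succ j)).le)

theorem prodFun_differentiable (n : ℕ) : Differentiable ℂ (prodFun n) := by
  unfold prodFun
  fun_prop

theorem powerSumFun_mapsTo {n : ℕ} (hn : 1 ≤ n) {α : Fin n → ℂ} (hα : ∀ j, α j ≠ 0)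
    (hsum : ∑ j, ‖α j‖ = 1) :
    Set.MapsTo (powerSumFun n α) (polydisc n) (Metric.ball 0 1) := by
  intro z hz
  simp only [Metric.mem_ball, dist_zero_right, powerSumFun]
  refine (norm_sum_le _ _).trans_lt ?_
  rw [← hsum]
  refine Finset.sum_lt_sum_of_nonempty ⟨⟨0, hn⟩, Finset.mem_univ _⟩ fun j _ => ?_
  rw [norm_mul, norm_pow]
  exact mul_lt_of_lt_one_right (norm_pos_iff.2 (hα j))
    (pow_lt_one₀ (norm_nonneg _) (hz j) (by omega))

theorem powerSumFun_differentiable (n : ℕ) (α : Fin n → ℂ) :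
    Differentiable ℂ (powerSumFun n α) := by
  unfold powerSumFun
  fun_prop

end

/-!
The composition operators in question factor through the restriction `F ↦ F (t, …, t, 0)` to the
diagonal, and their boundedness is a comparison of two power laws.

*The diagonal.* The product of the one-variable reproducing kernels reproduces every integrable
holomorphic function on the polydisc (`integral_mul_prod_discKernel`). Expanding the kernel at
`(t, …, t, 0)` in powers of `t` shows that the `k`-th Taylor coefficient of `t ↦ F (t, …, t, 0)` is
the inner product of `F` with a homogeneous polynomial `diagKernel n β k` of degree `k`
(`hasSum_diag`). These polynomials are pairwise orthogonal, with squared norms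
`A k = diagKernelNormSq n β k`.

*The criterion.* If `φ` is homogeneous of positive degree then its powers are pairwise orthogonal,
by rotation invariance; let `N k` be their squared norms. For `F` with diagonal coefficients `g k`,
Fatou's lemma and Bessel's inequality give
`‖F ∘ Φ(φ)‖² ≤ ∑ |g k|² N k ≤ sup (A k * N k) * ∑ |g k|² / A k ≤ sup (A k * N k) * ‖F‖²`,
and the choice `F = diagKernel n β k` shows that the supremum cannot be avoided
(`isBoundedCompOp_diagonalMap_iff`).

*The power laws.* With `ω k = ∫ |z|^{2k} dA_β`, a Beta integral, Euler's limit formula for the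
Gamma function gives `ω k ≍ (k + 1)^{-(β + 1)}`. The `A k` are iterated Cauchy products of `1 / ω`,
hence `A k ≍ (k + 1)^{(n - 1)(β + 2) - 1}` for `n ≥ 2`. For `z₁ ⋯ zₙ` one has `N k = (ω k)ⁿ`. For
`α₁ z₁ⁿ + ⋯ + αₙ zₙⁿ` one has `N k = ∑ M_κ² ∏ ω (n κ_j)`, where `M_κ` is the multinomial
probability of the counts `κ` with cell probabilities `|α_j|`, and
`N k ≍ (k + 1)^{-(n - 1)/2 - n(β + 1)}` (`hasPowerOrder_sum_multinomialProb_sq`). Here the upper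
bound uses Stirling's formula for one factor `M_κ` and negative moments of the multinomial
distribution for the rest. The lower bound is the Cauchy-Schwarz inequality on the counts at
distance `O(√k)` from their means, which carry at least half of the mass. Comparing exponents gives
the two conditions.
-/

noncomputable section

open Filter Topology ComplexConjugate

/-! ### Sequences of exact polynomial order -/

/-- `u k` lies between two positive multiples of `(k + 1) ^ p`. -/
def HasPowerOrder (u : ℕ → ℝ) (p : ℝ) : Prop :=
  ∃ c C : ℝ, 0 < c ∧ 0 < C ∧ ∀ k : ℕ, c * ((k : ℝ) + 1) ^ p ≤ u k ∧ u k ≤ C * ((k : ℝ) + 1) ^ p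

namespace HasPowerOrder

variable {u v : ℕ → ℝ} {p q : ℝ}

lemma pos (hu : HasPowerOrder u p) (k : ℕ) : 0 < u k := by
  obtain ⟨c, C, hc, hC, h⟩ := hu
  exact lt_of_lt_of_le (by positivity) (h k).1

lemma of_tendsto (hpos : ∀ k, 0 < u k) {L : ℝ} (hL : 0 < L)
    (hlim : Tendsto (fun k : ℕ => u k / ((k : ℝ) + 1) ^ p) atTop (𝓝 L)) : HasPowerOrder u p := by
  have hpos' : ∀ k : ℕ, 0 < u k / ((k : ℝ) + 1) ^ p := fun k => div_pos (hpos k) (by positivity)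
  obtain ⟨C, hC⟩ := hlim.bddAbove_range
  obtain ⟨c, hc⟩ := (hlim.inv₀ hL.ne').bddAbove_range
  have hc0 : 0 < c := (inv_pos.2 (hpos' 0)).trans_le (hc ⟨0, rfl⟩)
  refine ⟨c⁻¹, C, inv_pos.2 hc0, (hpos' 0).trans_le (hC ⟨0, rfl⟩), fun k => ?_⟩
  rw [← le_div_iff₀ (by positivity), ← div_le_iff₀ (by positivity)]
  exact ⟨inv_le_of_inv_le₀ (hpos' k) (hc ⟨k, rfl⟩), hC ⟨k, rfl⟩⟩

lemma comp_mul (hu : HasPowerOrder u p) (hp : p ≤ 0) {n : ℕ} (hn : 1 ≤ n) :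
    HasPowerOrder (fun k => u (n * k)) p := by
  obtain ⟨c, C, hc, hC, h⟩ := hu
  have hn' : (1 : ℝ) ≤ n := by exact_mod_cast hn
  refine ⟨c * (n : ℝ) ^ p, C, by positivity, hC, fun k => ⟨le_trans ?_ (h (n * k)).1,
    (h (n * k)).2.trans ?_⟩⟩
  · rw [mul_assoc, ← Real.mul_rpow (by positivity) (by positivity)]
    refine mul_le_mul_of_nonneg_left ?_ hc.le
    refine Real.rpow_le_rpow_of_nonpos (by positivity) ?_ hp
    push_cast
    linarith
  · refine mul_le_mul_of_nonneg_left ?_ hC.le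
    refine Real.rpow_le_rpow_of_nonpos (by positivity) ?_ hp
    push_cast
    have : (0 : ℝ) ≤ k := by positivity
    nlinarith

lemma inv (hu : HasPowerOrder u p) : HasPowerOrder (fun k => (u k)⁻¹) (-p) := by
  have hp := hu.pos
  obtain ⟨c, C, hc, hC, h⟩ := hu
  refine ⟨C⁻¹, c⁻¹, by positivity, by positivity, fun k => ?_⟩
  rw [Real.rpow_neg (by positivity), ← mul_inv, ← mul_inv]
  exact ⟨inv_anti₀ (hp k) (h k).2, inv_anti₀ (by positivity) (h k).1⟩

lemma mul (hu : HasPowerOrder u p) (hv : HasPowerOrder v q) :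
    HasPowerOrder (fun k => u k * v k) (p + q) := by
  have hup := hu.pos
  have hvp := hv.pos
  obtain ⟨c, C, hc, hC, h⟩ := hu
  obtain ⟨c', C', hc', hC', h'⟩ := hv
  refine ⟨c * c', C * C', by positivity, by positivity, fun k => ?_⟩
  rw [Real.rpow_add (by positivity), mul_mul_mul_comm c, mul_mul_mul_comm C]
  have := (hup k).le
  have := (hvp k).le
  exact ⟨mul_le_mul (h k).1 (h' k).1 (by positivity) (by positivity),
    mul_le_mul (h k).2 (h' k).2 (by positivity) (by positivity)⟩

lemma pow (hu : HasPowerOrder u p) (n : ℕ) : HasPowerOrder (fun k => u k ^ n) (n * p) := by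
  induction n with
  | zero => exact ⟨1, 1, by simp, by simp, fun k => by simp⟩
  | succ n ih =>
    have := ih.mul hu
    simp only [← pow_succ] at this
    convert this using 1
    push_cast
    ring

lemma bounded_iff (hu : HasPowerOrder u p) : (∃ B, ∀ k, u k ≤ B) ↔ p ≤ 0 := by
  obtain ⟨c, C, hc, hC, h⟩ := hu
  constructor
  · rintro ⟨B, hB⟩
    by_contra! hp
    have h1 : Tendsto (fun k : ℕ => ((k : ℝ) + 1) ^ p) atTop atTop :=
      (tendsto_rpow_atTop hp).comp (tendsto_atTop_add_const_right _ _ tendsto_natCast_atTop_atTop)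
    obtain ⟨k, hk⟩ := (h1.eventually_gt_atTop (B / c)).exists
    rw [div_lt_iff₀' hc] at hk
    exact absurd ((h k).1.trans (hB k)) (not_le.2 hk)
  · intro hp
    refine ⟨C, fun k => (h k).2.trans ?_⟩
    exact mul_le_of_le_one_right hC.le (Real.rpow_le_one_of_one_le_of_nonpos (by simp) hp)

/-- Cauchy products: the lower bound comes from the middle third of the antidiagonal. -/
lemma antidiagonal (hu : HasPowerOrder u p) (hv : HasPowerOrder v q) (hp : 0 ≤ p) (hq : 0 ≤ q) :
    HasPowerOrder (fun k => ∑ x ∈ Finset.HasAntidiagonal.antidiagonal k, u x.1 * v x.2)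
      (p + q + 1) := by
  have hup := hu.pos
  have hvp := hv.pos
  obtain ⟨c, C, hc, hC, h⟩ := hu
  obtain ⟨c', C', hc', hC', h'⟩ := hv
  refine ⟨c * c' * (1 / 3) ^ (p + q + 1), C * C', by positivity, by positivity, fun k => ⟨?_, ?_⟩⟩
  · set m := k / 3 with hm
    have hkm : (k : ℝ) + 1 ≤ 3 * ((m : ℝ) + 1) := by
      have : k + 1 ≤ 3 * (m + 1) := by omega
      exact_mod_cast this
    have hsub : (Finset.Icc m (2 * m)).image (fun i => (i, k - i)) ⊆
        Finset.HasAntidiagonal.antidiagonal k := by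
      intro x hx
      obtain ⟨i, hi, rfl⟩ := Finset.mem_image.1 hx
      rw [Finset.mem_Icc] at hi
      rw [Finset.HasAntidiagonal.mem_antidiagonal]
      omega
    calc c * c' * (1 / 3) ^ (p + q + 1) * ((k : ℝ) + 1) ^ (p + q + 1)
        = c * c' * (((k : ℝ) + 1) / 3) ^ (p + q + 1) := by
          rw [mul_assoc, ← Real.mul_rpow (by positivity) (by positivity)]
          ring_nf
      _ ≤ c * c' * ((m : ℝ) + 1) ^ (p + q + 1) := by
          gcongr
          linarith
      _ = ∑ i ∈ Finset.Icc m (2 * m), (c * ((m : ℝ) + 1) ^ p) * (c' * ((m : ℝ) + 1) ^ q) := by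
          rw [Finset.sum_const, Nat.card_Icc, Real.rpow_add (by positivity),
            Real.rpow_add (by positivity), Real.rpow_one, nsmul_eq_mul,
            show 2 * m + 1 - m = m + 1 by omega]
          push_cast
          ring
      _ ≤ ∑ i ∈ Finset.Icc m (2 * m), u i * v (k - i) := by
          refine Finset.sum_le_sum fun i hi => ?_
          rw [Finset.mem_Icc] at hi
          have h1 : (m : ℝ) ≤ i := by exact_mod_cast hi.1
          have h2 : (m : ℝ) ≤ (k - i : ℕ) := by
            have : m ≤ k - i := by omega
            exact_mod_cast this
          have := (hup i).le
          refine mul_le_mul (le_trans ?_ (h i).1) (le_trans ?_ (h' _).1) (by positivity) this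
          · gcongr
          · gcongr
      _ = ∑ x ∈ (Finset.Icc m (2 * m)).image (fun i => (i, k - i)), u x.1 * v x.2 := by
          rw [Finset.sum_image fun a _ b _ hab => (Prod.ext_iff.1 hab).1]
      _ ≤ _ := Finset.sum_le_sum_of_subset_of_nonneg hsub fun x _ _ =>
          mul_nonneg (hup _).le (hvp _).le
  · calc _ ≤ ∑ x ∈ Finset.HasAntidiagonal.antidiagonal k,
          (C * ((k : ℝ) + 1) ^ p) * (C' * ((k : ℝ) + 1) ^ q) := by
          refine Finset.sum_le_sum fun x hx => ?_
          have hx := Finset.HasAntidiagonal.mem_antidiagonal.1 hx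
          have h1 : (x.1 : ℝ) ≤ k := by exact_mod_cast (by omega : x.1 ≤ k)
          have h2 : (x.2 : ℝ) ≤ k := by exact_mod_cast (by omega : x.2 ≤ k)
          refine mul_le_mul ((h _).2.trans ?_) ((h' _).2.trans ?_) (hvp _).le (by positivity)
          · gcongr
          · gcongr
      _ = _ := by
          rw [Finset.sum_const, Finset.Nat.card_antidiagonal, Real.rpow_add (by positivity),
            Real.rpow_add (by positivity), Real.rpow_one, nsmul_eq_mul]
          push_cast
          ring

end HasPowerOrder

/-! ### The weighted area measure on the disc -/

/-- The density of `dA_β` with respect to Lebesgue measure on `ℂ`, extended by zero off the disc. -/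
def discDensity (β : ℝ) (z : ℂ) : ℝ :=
  (Metric.ball (0 : ℂ) 1).indicator (fun z => (β + 1) / Real.pi * (1 - ‖z‖ ^ 2) ^ β) z

lemma discDensity_nonneg {β : ℝ} (hβ : -1 < β) (z : ℂ) : 0 ≤ discDensity β z := by
  refine Set.indicator_nonneg (fun z hz => ?_) z
  have h1 : ‖z‖ < 1 := by simpa using hz
  have h2 : 0 ≤ 1 - ‖z‖ ^ 2 := by nlinarith [norm_nonneg z]
  have h3 : 0 < β + 1 := by linarith
  have := Real.rpow_nonneg h2 β
  positivity

lemma measurable_discDensity (β : ℝ) : Measurable (discDensity β) := by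
  unfold discDensity
  exact Measurable.indicator (by fun_prop) measurableSet_ball

lemma weightedDiscArea_eq_withDensity (β : ℝ) :
    weightedDiscArea β = volume.withDensity fun z => ENNReal.ofReal (discDensity β z) := by
  have hm : Measurable fun z : ℂ => ENNReal.ofReal ((β + 1) * (1 - ‖z‖ ^ 2) ^ β) := by fun_prop
  rw [weightedDiscArea, discArea, withDensity_smul_measure, ← withDensity_indicator measurableSet_ball,
    ← withDensity_smul _ (hm.indicator measurableSet_ball)]
  congr 1
  ext z
  by_cases hz : z ∈ Metric.ball (0 : ℂ) 1
  · simp only [Pi.smul_apply, smul_eq_mul, discDensity, Set.indicator_of_mem hz]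
    rw [← ENNReal.ofReal_mul (by positivity)]
    congr 1
    ring
  · simp [discDensity, Set.indicator_of_notMem hz]

lemma integral_weightedDiscArea {E : Type*} [NormedAddCommGroup E] [NormedSpace ℝ E] {β : ℝ}
    (hβ : -1 < β) (f : ℂ → E) :
    ∫ z, f z ∂(weightedDiscArea β) = ∫ z, discDensity β z • f z := by
  rw [weightedDiscArea_eq_withDensity, integral_withDensity_eq_integral_toReal_smul
    (measurable_discDensity β).ennreal_ofReal (by simp)]
  simp [ENNReal.toReal_ofReal (discDensity_nonneg hβ _)]

lemma integrable_weightedDiscArea {E : Type*} [NormedAddCommGroup E] [NormedSpace ℝ E] {β : ℝ}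
    (hβ : -1 < β) (f : ℂ → E) :
    Integrable f (weightedDiscArea β) ↔ Integrable fun z => discDensity β z • f z := by
  rw [weightedDiscArea_eq_withDensity, integrable_withDensity_iff_integrable_smul'
    (measurable_discDensity β).ennreal_ofReal (by simp)]
  simp [ENNReal.toReal_ofReal (discDensity_nonneg hβ _)]

/-- The density times `|z|^{2k}` is, off the origin, a multiple of a Beta density in `|z|²`. -/
lemma discDensity_mul_norm_pow {β : ℝ} (hβ : -1 < β) (k : ℕ) {z : ℂ} (hz : z ≠ 0) :
    discDensity β z * ‖z‖ ^ (2 * k) = (β + 1) / Real.pi * ProbabilityTheory.beta (k + 1) (β + 1) *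
      ProbabilityTheory.betaPDFReal (k + 1) (β + 1) (‖z‖ ^ 2) := by
  have hz0 : 0 < ‖z‖ ^ 2 := by positivity
  have hB : 0 < ProbabilityTheory.beta (k + 1) (β + 1) :=
    ProbabilityTheory.beta_pos (by positivity) (by linarith)
  by_cases h : ‖z‖ < 1
  · have h2 : ‖z‖ ^ 2 < 1 := by nlinarith [norm_nonneg z]
    rw [discDensity, Set.indicator_of_mem (by simpa using h), ProbabilityTheory.betaPDFReal,
      if_pos ⟨hz0, h2⟩]
    simp only [add_sub_cancel_right, Real.rpow_natCast, pow_mul]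
    field_simp
  · have h2 : ¬ ‖z‖ ^ 2 < 1 := by nlinarith [norm_nonneg z]
    rw [discDensity, Set.indicator_of_notMem (by simpa using h), ProbabilityTheory.betaPDFReal,
      if_neg (fun h => h2 h.2)]
    simp

lemma integrable_betaPDFReal {a b : ℝ} (ha : 0 < a) (hb : 0 < b) :
    Integrable (ProbabilityTheory.betaPDFReal a b) ∧
      ∫ x, ProbabilityTheory.betaPDFReal a b x = 1 := by
  have h0 : ∀ x, 0 ≤ ProbabilityTheory.betaPDFReal a b x := fun x => by
    by_cases h : 0 < x ∧ x < 1
    · exact (ProbabilityTheory.betaPDFReal_pos h.1 h.2 ha hb).le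
    · simp [ProbabilityTheory.betaPDFReal, h]
  have h1 := ProbabilityTheory.lintegral_betaPDF_eq_one ha hb
  have hs := (ProbabilityTheory.stronglyMeasurable_betaPDFReal a b).aestronglyMeasurable
    (μ := volume)
  constructor
  · refine (lintegral_ofReal_ne_top_iff_integrable hs (ae_of_all _ h0)).1 ?_
    simp only [ProbabilityTheory.betaPDF] at h1
    simp [h1]
  · rw [integral_eq_lintegral_of_nonneg_ae (ae_of_all _ h0) hs]
    simp only [ProbabilityTheory.betaPDF] at h1
    simp [h1]

/-- The moments `ω_k = ∫ |z|^{2k} dA_β` of the weighted area measure. -/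
def discMoment (β : ℝ) (k : ℕ) : ℝ := ∫ z, ‖z‖ ^ (2 * k) ∂(weightedDiscArea β)

lemma ae_ne_zero_complex : ∀ᵐ z : ℂ, z ≠ 0 := by
  simp [ae_iff, measure_singleton]

lemma integrable_norm_pow_weightedDiscArea {β : ℝ} (hβ : -1 < β) (k : ℕ) :
    Integrable (fun z : ℂ => ‖z‖ ^ (2 * k)) (weightedDiscArea β) := by
  rw [integrable_weightedDiscArea hβ]
  have hb := (integrable_betaPDFReal (a := k + 1) (b := β + 1) (by positivity) (by linarith)).1
  have h2 : Integrable fun z : ℂ => ProbabilityTheory.betaPDFReal (k + 1) (β + 1) (‖z‖ ^ 2) := by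
    refine (integrable_fun_norm_addHaar volume
      (f := fun y => ProbabilityTheory.betaPDFReal (k + 1) (β + 1) (y ^ 2))).2 ?_
    have := (integrableOn_Ioi_comp_rpow_iff (ProbabilityTheory.betaPDFReal (k + 1) (β + 1))
      (p := 2) (by norm_num)).2 hb.integrableOn
    refine (this.const_mul (1 / 2)).congr ?_
    refine ae_of_all _ fun x => ?_
    norm_num [Complex.finrank_real_complex]
    ring
  refine (h2.const_mul ((β + 1) / Real.pi * ProbabilityTheory.beta (k + 1) (β + 1))).congr ?_
  filter_upwards [ae_ne_zero_complex] with z hz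
  rw [smul_eq_mul, discDensity_mul_norm_pow hβ k hz]

lemma discMoment_eq_beta {β : ℝ} (hβ : -1 < β) (k : ℕ) :
    discMoment β k = (β + 1) * ProbabilityTheory.beta (k + 1) (β + 1) := by
  obtain ⟨hb, hb1⟩ := integrable_betaPDFReal (a := k + 1) (b := β + 1) (by positivity) (by linarith)
  rw [discMoment, integral_weightedDiscArea hβ]
  have h1 : ∫ z : ℂ, discDensity β z • ‖z‖ ^ (2 * k) =
      ∫ z : ℂ, (β + 1) / Real.pi * ProbabilityTheory.beta (k + 1) (β + 1) *
      ProbabilityTheory.betaPDFReal (k + 1) (β + 1) (‖z‖ ^ 2) := by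
    refine integral_congr_ae ?_
    filter_upwards [ae_ne_zero_complex] with z hz
    rw [smul_eq_mul, discDensity_mul_norm_pow hβ k hz]
  rw [h1, integral_const_mul, integral_fun_norm_addHaar (E := ℂ) volume
      (fun y => ProbabilityTheory.betaPDFReal (k + 1) (β + 1) (y ^ 2))]
  have h2 := integral_comp_rpow_Ioi_of_pos (E := ℝ) (g := ProbabilityTheory.betaPDFReal (k + 1) (β + 1))
    (p := 2) (by norm_num)
  have h3 : ∫ y in Set.Ioi (0 : ℝ), ProbabilityTheory.betaPDFReal (k + 1) (β + 1) y = 1 := by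
    refine (setIntegral_eq_integral_of_forall_compl_eq_zero fun x hx => ?_).trans hb1
    have : ¬ 0 < x := hx
    simp [ProbabilityTheory.betaPDFReal, this]
  rw [h3] at h2
  have h4 : ∫ y in Set.Ioi (0 : ℝ), y ^ (Module.finrank ℝ ℂ - 1) •
      ProbabilityTheory.betaPDFReal (k + 1) (β + 1) (y ^ 2) = 1 / 2 := by
    have h5 : (1 : ℝ) / 2 = 1 / 2 * ∫ x in Set.Ioi (0 : ℝ), ((2 : ℝ) * x ^ ((2 : ℝ) - 1)) •
        ProbabilityTheory.betaPDFReal (k + 1) (β + 1) (x ^ (2 : ℝ)) := by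
      rw [h2, mul_one]
    rw [h5, ← integral_const_mul]
    refine integral_congr_ae (ae_of_all _ fun x => ?_)
    norm_num [Complex.finrank_real_complex]
    ring
  rw [h4]
  have : volume.real (Metric.ball (0 : ℂ) 1) = Real.pi := by
    simp [Measure.real, Complex.volume_ball]
  rw [this]
  simp [Complex.finrank_real_complex]
  field_simp

lemma discMoment_eq_gammaSeq {β : ℝ} (hβ : -1 < β) (k : ℕ) :
    (k : ℝ) ^ (β + 1) * discMoment β k = (β + 1) * Real.GammaSeq (β + 1) k := by
  have hs : 0 < β + 1 := by linarith
  have hG : ∀ k : ℕ, Real.Gamma (β + 1 + k + 1) =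
      Real.Gamma (β + 1) * ∏ j ∈ Finset.range (k + 1), (β + 1 + j) := by
    intro k
    induction k with
    | zero => simp [Real.Gamma_add_one hs.ne', mul_comm]
    | succ k ih =>
      rw [Finset.prod_range_succ, ← mul_assoc, ← ih, Nat.cast_succ,
        Real.Gamma_add_one (by positivity)]
      ring_nf
  have hP : 0 < ∏ j ∈ Finset.range (k + 1), (β + 1 + (j : ℝ)) :=
    Finset.prod_pos fun _ _ => by positivity
  have hGs := Real.Gamma_pos_of_pos hs
  rw [discMoment_eq_beta hβ, ProbabilityTheory.beta, Real.Gamma_nat_eq_factorial,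
    show (k : ℝ) + 1 + (β + 1) = β + 1 + k + 1 by ring, hG, Real.GammaSeq]
  field_simp

lemma discMoment_pos {β : ℝ} (hβ : -1 < β) (k : ℕ) : 0 < discMoment β k := by
  rw [discMoment_eq_beta hβ]
  exact mul_pos (by linarith) (ProbabilityTheory.beta_pos (by positivity) (by linarith))

lemma discMoment_zero {β : ℝ} (hβ : -1 < β) : discMoment β 0 = 1 := by
  have hs : 0 < β + 1 := by linarith
  rw [discMoment_eq_beta hβ, ProbabilityTheory.beta, Nat.cast_zero, zero_add,
    Real.Gamma_one, add_comm 1, Real.Gamma_add_one hs.ne']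
  have := Real.Gamma_pos_of_pos hs
  field_simp

lemma isProbabilityMeasure_weightedDiscArea {β : ℝ} (hβ : -1 < β) :
    IsProbabilityMeasure (weightedDiscArea β) := by
  have h1 := discMoment_zero hβ
  have h2 := integrable_norm_pow_weightedDiscArea hβ 0
  simp only [discMoment, mul_zero, pow_zero] at h1 h2
  simp only [integral_const, smul_eq_mul, mul_one, Measure.real] at h1
  exact ⟨(ENNReal.toReal_eq_one_iff _).1 h1⟩

/-- The moments decay like `(k + 1)^{-(β + 1)}`. -/
lemma hasPowerOrder_discMoment {β : ℝ} (hβ : -1 < β) :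
    HasPowerOrder (discMoment β) (-(β + 1)) := by
  have hs : 0 < β + 1 := by linarith
  refine HasPowerOrder.of_tendsto (discMoment_pos hβ) (mul_pos hs (Real.Gamma_pos_of_pos hs)) ?_
  have h1 := (Real.GammaSeq_tendsto_Gamma (β + 1)).const_mul (β + 1)
  have h2 : Tendsto (fun k : ℕ => (1 + 1 / (k : ℝ)) ^ (β + 1)) atTop (𝓝 ((1 + 0) ^ (β + 1))) :=
    (tendsto_const_nhds.add tendsto_one_div_atTop_nhds_zero_nat).rpow_const (Or.inr hs.le)
  have h3 := h2.mul h1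
  simp only [add_zero, Real.one_rpow, one_mul] at h3
  refine h3.congr' ?_
  filter_upwards [eventually_gt_atTop 0] with k hk
  have hk' : (0 : ℝ) < k := by exact_mod_cast hk
  rw [← discMoment_eq_gammaSeq hβ, Real.rpow_neg (by positivity), div_inv_eq_mul, ← mul_assoc,
    ← Real.mul_rpow (by positivity) hk'.le, mul_comm (discMoment β k)]
  congr 2
  field_simp

lemma ae_mem_ball_weightedDiscArea (β : ℝ) :
    ∀ᵐ z ∂(weightedDiscArea β), z ∈ Metric.ball (0 : ℂ) 1 := by
  have h : weightedDiscArea β ≪ discArea := withDensity_absolutelyContinuous _ _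
  refine h.ae_le ?_
  rw [discArea]
  refine Measure.ae_smul_measure (ae_restrict_mem measurableSet_ball) _

lemma measurePreserving_mul_weightedDiscArea (β : ℝ) {c : ℂ} (hc : ‖c‖ = 1) :
    MeasurePreserving (fun z => c * z) (weightedDiscArea β) (weightedDiscArea β) := by
  have hvol : MeasurePreserving (fun z : ℂ => c * z) volume volume := by
    exact (rotation (⟨c, by simp [Submonoid.unitSphere, hc]⟩ : Circle)).measurePreserving
  refine ⟨by fun_prop, ?_⟩
  rw [weightedDiscArea_eq_withDensity]
  ext s hs
  rw [Measure.map_apply (by fun_prop) hs, withDensity_apply _ hs,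
    withDensity_apply _ (by measurability)]
  rw [← hvol.setLIntegral_comp_preimage hs (measurable_discDensity β).ennreal_ofReal]
  refine setLIntegral_congr_fun (by measurability) fun z _ => ?_
  simp [discDensity, Set.indicator, hc]

/-! ### The reproducing formula in one variable -/

/-- A function that a measure preserving symmetry multiplies by a constant `c ≠ 1` has integral
zero. -/
lemma MeasureTheory.MeasurePreserving.integral_eq_zero_of_comp_eq_mul {X : Type*}
    [MeasurableSpace X] {μ : Measure X} {T : X → X} (hT : MeasurePreserving T μ μ)
    {f : X → ℂ} (hf : AEStronglyMeasurable f μ) {c : ℂ} (hc : c ≠ 1)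
    (h : ∀ x, f (T x) = c * f x) : ∫ x, f x ∂μ = 0 := by
  have h1 : ∫ x, f (T x) ∂μ = ∫ x, f x ∂μ := by
    conv_rhs => rw [← hT.map_eq]
    rw [integral_map hT.measurable.aemeasurable (by rwa [hT.map_eq])]
  simp only [h, integral_const_mul] at h1
  have h2 : (c - 1) * ∫ x, f x ∂μ = 0 := by linear_combination h1
  exact (mul_eq_zero.1 h2).resolve_left (sub_ne_zero.2 hc)

/-- Distinct characters of the circle are separated by some point. -/
lemma exists_norm_eq_one_pow_mul_conj_pow_ne_one {k l : ℕ} (h : k ≠ l) :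
    ∃ c : ℂ, ‖c‖ = 1 ∧ c ^ k * conj c ^ l ≠ 1 := by
  have key : ∀ m : ℕ, 0 < m → ∃ c : ℂ, ‖c‖ = 1 ∧ c ^ m = -1 := fun m hm => by
    refine ⟨Complex.exp ((Real.pi / m : ℝ) * Complex.I), Complex.norm_exp_ofReal_mul_I _, ?_⟩
    have hm' : (m : ℂ) ≠ 0 := by exact_mod_cast hm.ne'
    rw [← Complex.exp_nat_mul, ← Complex.exp_pi_mul_I]
    congr 1
    push_cast
    field_simp
  have hu : ∀ c : ℂ, ‖c‖ = 1 → ∀ j, c ^ j * conj c ^ j = 1 := fun c hc j => by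
    rw [← mul_pow, Complex.mul_conj, Complex.normSq_eq_norm_sq, hc]
    simp
  rcases lt_or_gt_of_ne h with h | h
  · obtain ⟨m, rfl⟩ := Nat.exists_eq_add_of_lt h
    obtain ⟨c, hc, hcm⟩ := key (m + 1) (by omega)
    refine ⟨c, hc, ?_⟩
    rw [show k + m + 1 = k + (m + 1) by ring, pow_add, ← mul_assoc, hu c hc, one_mul, ← map_pow, hcm]
    norm_num
  · obtain ⟨m, rfl⟩ := Nat.exists_eq_add_of_lt h
    obtain ⟨c, hc, hcm⟩ := key (m + 1) (by omega)
    refine ⟨c, hc, ?_⟩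
    rw [show l + m + 1 = (m + 1) + l by ring, pow_add, mul_assoc, hu c hc, mul_one, hcm]
    norm_num

lemma setIntegral_pow_mul_conj_pow_eq_zero (β r : ℝ) {k l : ℕ} (h : k ≠ l) :
    ∫ z in Metric.ball (0 : ℂ) r, z ^ k * conj z ^ l ∂(weightedDiscArea β) = 0 := by
  obtain ⟨c, hc, hckl⟩ := exists_norm_eq_one_pow_mul_conj_pow_ne_one h
  rw [← integral_indicator measurableSet_ball]
  refine (measurePreserving_mul_weightedDiscArea β hc).integral_eq_zero_of_comp_eq_mul
    (f := (Metric.ball (0 : ℂ) r).indicator fun z => z ^ k * conj z ^ l) ?_ hckl fun z => ?_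
  · exact (Continuous.aestronglyMeasurable (by fun_prop)).indicator measurableSet_ball
  · by_cases hz : ‖z‖ < r
    · simp [Set.indicator, hc, hz]
      ring
    · simp [Set.indicator, hc, hz]

lemma pow_mul_conj_pow_self (z : ℂ) (k : ℕ) : z ^ k * conj z ^ k = ((‖z‖ ^ (2 * k) : ℝ) : ℂ) := by
  rw [← mul_pow, Complex.mul_conj, Complex.normSq_eq_norm_sq, pow_mul]
  push_cast
  rfl

lemma integral_pow_mul_conj_pow {β : ℝ} (k l : ℕ) :
    ∫ z, z ^ k * conj z ^ l ∂(weightedDiscArea β) = if k = l then (discMoment β k : ℂ) else 0 := by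
  split_ifs with h
  · subst h
    simp only [pow_mul_conj_pow_self]
    exact integral_ofReal
  · obtain ⟨c, hc, hckl⟩ := exists_norm_eq_one_pow_mul_conj_pow_ne_one h
    refine (measurePreserving_mul_weightedDiscArea β hc).integral_eq_zero_of_comp_eq_mul
      (f := fun z => z ^ k * conj z ^ l) (Continuous.aestronglyMeasurable (by fun_prop))
      hckl fun z => ?_
    simp only [map_mul]
    ring

lemma tendsto_setIntegral_ball (β : ℝ) {f : ℂ → ℂ} (hf : Integrable f (weightedDiscArea β)) :
    Tendsto (fun N : ℕ => ∫ z in Metric.ball (0 : ℂ) (1 - 1 / ((N : ℝ) + 1)), f z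
      ∂(weightedDiscArea β)) atTop (𝓝 (∫ z, f z ∂(weightedDiscArea β))) := by
  have hmono : Monotone fun N : ℕ => Metric.ball (0 : ℂ) (1 - 1 / ((N : ℝ) + 1)) := by
    intro M N hMN
    refine Metric.ball_subset_ball ?_
    have : (M : ℝ) ≤ N := by exact_mod_cast hMN
    gcongr
  have hU : ⋃ N : ℕ, Metric.ball (0 : ℂ) (1 - 1 / ((N : ℝ) + 1)) = Metric.ball 0 1 := by
    ext z
    simp only [Set.mem_iUnion, Metric.mem_ball, dist_zero_right]
    constructor
    · rintro ⟨N, hN⟩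
      have : (0 : ℝ) < 1 / ((N : ℝ) + 1) := by positivity
      linarith
    · intro hz
      obtain ⟨N, hN⟩ := exists_nat_one_div_lt (sub_pos.2 hz)
      exact ⟨N, by linarith⟩
  have := tendsto_setIntegral_of_monotone (fun N : ℕ => measurableSet_ball
    (x := (0 : ℂ)) (ε := 1 - 1 / ((N : ℝ) + 1))) hmono (hf.integrableOn (μ := weightedDiscArea β))
  rwa [hU, Measure.restrict_eq_self_of_ae_mem (ae_mem_ball_weightedDiscArea β)] at this

/-- On a smaller disc the power series may be integrated term by term. -/
lemma setIntegral_mul_conj_pow {β : ℝ} (hβ : -1 < β) {h : ℂ → ℂ} {a : ℕ → ℂ}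
    (ha : ∀ z ∈ Metric.ball (0 : ℂ) 1, HasSum (fun k => a k * z ^ k) (h z)) (l : ℕ)
    {r : ℝ} (hr0 : 0 ≤ r) (hr1 : r < 1) :
    ∫ z in Metric.ball (0 : ℂ) r, h z * conj z ^ l ∂(weightedDiscArea β) =
      a l * ∫ z in Metric.ball (0 : ℂ) r, z ^ l * conj z ^ l ∂(weightedDiscArea β) := by
  have := isProbabilityMeasure_weightedDiscArea hβ
  have hbd : ∀ k : ℕ, ∀ z ∈ Metric.ball (0 : ℂ) r,
      ‖a k * z ^ k * conj z ^ l‖ ≤ ‖a k * (r : ℂ) ^ k‖ := by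
    intro k z hz
    have hz : ‖z‖ ≤ r := by simpa using (Metric.mem_ball.1 hz).le
    simp only [norm_mul, norm_pow, RCLike.norm_conj, Complex.norm_real, Real.norm_eq_abs,
      abs_of_nonneg hr0]
    calc ‖a k‖ * ‖z‖ ^ k * ‖z‖ ^ l ≤ ‖a k‖ * r ^ k * 1 := by
          gcongr
          exact pow_le_one₀ (norm_nonneg _) (hz.trans hr1.le)
      _ = _ := mul_one _
  have hsum : Summable fun k => ‖a k * (r : ℂ) ^ k‖ :=
    (ha r (by simpa [abs_of_nonneg hr0] using hr1)).summable.norm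
  have hint : ∀ k, IntegrableOn (fun z => a k * z ^ k * conj z ^ l) (Metric.ball (0 : ℂ) r)
      (weightedDiscArea β) := fun k =>
    Measure.integrableOn_of_bounded (M := ‖a k * (r : ℂ) ^ k‖) (measure_ne_top _ _)
      (Continuous.aestronglyMeasurable (by fun_prop))
      ((ae_restrict_mem measurableSet_ball).mono fun z hz => hbd k z hz)
  have h1 := hasSum_integral_of_summable_integral_norm hint
    (hsum.of_nonneg_of_le (fun k => integral_nonneg fun _ => norm_nonneg _) fun k => by
      calc _ ≤ ∫ z in Metric.ball (0 : ℂ) r, ‖a k * (r : ℂ) ^ k‖ ∂(weightedDiscArea β) :=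
            setIntegral_mono_on (hint k).norm (integrable_const _) measurableSet_ball (hbd k)
        _ = (weightedDiscArea β).real (Metric.ball (0 : ℂ) r) * ‖a k * (r : ℂ) ^ k‖ := by simp
        _ ≤ 1 * ‖a k * (r : ℂ) ^ k‖ := by gcongr; exact measureReal_le_one
        _ = _ := one_mul _)
  have h2 : ∫ z in Metric.ball (0 : ℂ) r, ∑' k, a k * z ^ k * conj z ^ l ∂(weightedDiscArea β) =
      ∫ z in Metric.ball (0 : ℂ) r, h z * conj z ^ l ∂(weightedDiscArea β) := by
    refine setIntegral_congr_fun measurableSet_ball fun z hz => ?_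
    exact ((ha z (Metric.ball_subset_ball hr1.le hz)).mul_right _).tsum_eq
  rw [h2] at h1
  refine h1.unique ?_
  convert hasSum_single l ?_ using 1
  · simp only [mul_assoc, integral_const_mul]
  · intro k hk
    simp only [mul_assoc, integral_const_mul, setIntegral_pow_mul_conj_pow_eq_zero β r hk,
      mul_zero]

lemma integral_mul_conj_pow {β : ℝ} (hβ : -1 < β) {h : ℂ → ℂ} {a : ℕ → ℂ}
    (ha : ∀ z ∈ Metric.ball (0 : ℂ) 1, HasSum (fun k => a k * z ^ k) (h z))
    (hi : Integrable h (weightedDiscArea β)) (l : ℕ) :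
    ∫ z, h z * conj z ^ l ∂(weightedDiscArea β) = a l * discMoment β l := by
  have := isProbabilityMeasure_weightedDiscArea hβ
  have hi1 : Integrable (fun z => h z * conj z ^ l) (weightedDiscArea β) := by
    refine hi.mul_bdd (c := 1) (Continuous.aestronglyMeasurable (by fun_prop)) ?_
    filter_upwards [ae_mem_ball_weightedDiscArea β] with z hz
    rw [norm_pow, RCLike.norm_conj]
    exact pow_le_one₀ (norm_nonneg _) (by simpa using (Metric.mem_ball.1 hz).le)
  have hi2 : Integrable (fun z : ℂ => z ^ l * conj z ^ l) (weightedDiscArea β) := by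
    simp only [pow_mul_conj_pow_self]
    exact (integrable_norm_pow_weightedDiscArea hβ l).ofReal
  have h3 := integral_pow_mul_conj_pow (β := β) l l
  rw [if_pos rfl] at h3
  rw [← h3]
  refine tendsto_nhds_unique (tendsto_setIntegral_ball β hi1) (((tendsto_setIntegral_ball β hi2).const_mul (a l)).congr fun N => ?_)
  refine (setIntegral_mul_conj_pow hβ ha l ?_ ?_).symm
  · rw [sub_nonneg, div_le_one (by positivity)]
    simp
  · have : (0 : ℝ) < 1 / ((N : ℝ) + 1) := by positivity
    linarith

lemma summable_pow_div_discMoment {β : ℝ} (hβ : -1 < β) {x : ℝ} (hx0 : 0 ≤ x) (hx : x < 1) :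
    Summable fun k => x ^ k / discMoment β k := by
  obtain ⟨c, _, hc, _, h⟩ := hasPowerOrder_discMoment hβ
  obtain ⟨N, hN⟩ := exists_nat_ge (β + 1)
  have h1 : Summable fun k : ℕ => ((k + 1 : ℕ) : ℝ) ^ N * x ^ (k + 1) :=
    (summable_nat_add_iff (f := fun k : ℕ => (k : ℝ) ^ N * x ^ k) 1).2
      (summable_pow_mul_geometric_of_norm_lt_one N (by rwa [Real.norm_of_nonneg hx0]))
  rcases hx0.eq_or_lt with rfl | hx0
  · refine summable_of_ne_finset_zero (s := {0}) fun k hk => ?_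
    rw [Finset.mem_singleton] at hk
    simp [hk]
  refine Summable.of_nonneg_of_le (fun k => div_nonneg (by positivity) (discMoment_pos hβ k).le)
    (fun k => ?_) (h1.mul_left (1 / (c * x)))
  calc x ^ k / discMoment β k ≤ x ^ k / (c * ((k : ℝ) + 1) ^ (-(N : ℝ))) := by
        gcongr
        refine le_trans ?_ (h k).1
        refine mul_le_mul_of_nonneg_left ?_ hc.le
        exact Real.rpow_le_rpow_of_exponent_le (by simp) (neg_le_neg hN)
    _ = _ := by
        rw [Real.rpow_neg (by positivity), Real.rpow_natCast, pow_succ]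
        push_cast
        field_simp

/-- The reproducing kernel of `A²_β(𝔻)`, as a function of the product `w * conj z`. -/
def discKernel (β : ℝ) (x : ℂ) : ℂ := ∑' k, x ^ k / discMoment β k

lemma discKernel_zero {β : ℝ} (hβ : -1 < β) : discKernel β 0 = 1 := by
  rw [discKernel, tsum_eq_single 0 fun k hk => by simp [hk]]
  simp [discMoment_zero hβ]

lemma norm_kernel_term_le {β : ℝ} (hβ : -1 < β) (w : ℂ) {z : ℂ} (hz : ‖z‖ < 1) (k : ℕ) :
    ‖(w * conj z) ^ k / (discMoment β k : ℂ)‖ ≤ ‖w‖ ^ k / discMoment β k := by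
  have := discMoment_pos hβ k
  rw [norm_div, norm_pow, norm_mul, RCLike.norm_conj, Complex.norm_real, Real.norm_of_nonneg this.le]
  gcongr
  exact mul_le_of_le_one_right (norm_nonneg _) hz.le

lemma continuousOn_discKernel {β : ℝ} (hβ : -1 < β) {w : ℂ} (hw : ‖w‖ < 1) :
    ContinuousOn (fun z => discKernel β (w * conj z)) (Metric.ball 0 1) := by
  refine continuousOn_tsum (fun k => Continuous.continuousOn (by fun_prop))
    (summable_pow_div_discMoment hβ (norm_nonneg w) hw) fun k z hz => ?_
  exact norm_kernel_term_le hβ w (by simpa using hz) k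

lemma norm_discKernel_le {β : ℝ} (hβ : -1 < β) {w : ℂ} (hw : ‖w‖ < 1) {z : ℂ} (hz : ‖z‖ < 1) :
    ‖discKernel β (w * conj z)‖ ≤ ∑' k, ‖w‖ ^ k / discMoment β k :=
  tsum_of_norm_bounded (summable_pow_div_discMoment hβ (norm_nonneg w) hw).hasSum
    fun k => norm_kernel_term_le hβ w hz k

/-- Integration against the kernel evaluates integrable holomorphic functions at `w`. -/
lemma integral_mul_discKernel {β : ℝ} (hβ : -1 < β) {h : ℂ → ℂ}
    (hh : DifferentiableOn ℂ h (Metric.ball 0 1)) (hi : Integrable h (weightedDiscArea β))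
    {w : ℂ} (hw : ‖w‖ < 1) :
    ∫ z, h z * discKernel β (w * conj z) ∂(weightedDiscArea β) = h w := by
  have ha : ∀ z ∈ Metric.ball (0 : ℂ) 1,
      HasSum (fun k : ℕ => (iteratedDeriv k h 0 / k.factorial) * z ^ k) (h z) := fun z hz => by
    have := Complex.hasSum_taylorSeries_on_ball hh hz
    refine this.congr_fun fun k => ?_
    simp only [sub_zero, smul_eq_mul]
    ring
  have hsum := summable_pow_div_discMoment hβ (norm_nonneg w) hw
  have hbd : ∀ k : ℕ, ∀ᵐ z ∂(weightedDiscArea β),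
      ‖(w * conj z) ^ k / (discMoment β k : ℂ)‖ ≤ ‖w‖ ^ k / discMoment β k := fun k => by
    filter_upwards [ae_mem_ball_weightedDiscArea β] with z hz
    exact norm_kernel_term_le hβ w (by simpa using hz) k
  have hint : ∀ k : ℕ, Integrable (fun z => h z * ((w * conj z) ^ k / (discMoment β k : ℂ)))
      (weightedDiscArea β) := fun k =>
    hi.mul_bdd (Continuous.aestronglyMeasurable (by fun_prop)) (hbd k)
  have h1 := hasSum_integral_of_summable_integral_norm hint
    (Summable.of_nonneg_of_le (fun k => integral_nonneg fun _ => norm_nonneg _) (fun k => by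
      calc _ ≤ ∫ z, ‖h z‖ * (‖w‖ ^ k / discMoment β k) ∂(weightedDiscArea β) := by
            refine integral_mono_ae (hint k).norm (hi.norm.mul_const _) ?_
            filter_upwards [hbd k] with z hz
            rw [norm_mul]
            gcongr
        _ = _ := integral_mul_const _ _) (hsum.mul_left _))
  simp only [tsum_mul_left] at h1
  refine h1.unique ((ha w (by simpa using hw)).congr_fun fun k => ?_)
  have hk : (discMoment β k : ℂ) ≠ 0 := by exact_mod_cast (discMoment_pos hβ k).ne'
  calc _ = ∫ z, (w ^ k / (discMoment β k : ℂ)) * (h z * conj z ^ k) ∂(weightedDiscArea β) := by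
        congr 1 with z
        rw [mul_pow]
        ring
    _ = _ := by
        rw [integral_const_mul, integral_mul_conj_pow hβ ha hi]
        field_simp

/-! ### Sums over compositions and products of series -/

lemma Finset.sum_piAntidiag_cons_prod {ι R : Type*} [DecidableEq ι] [CommSemiring R] {i : ι}
    {T : Finset ι} (hi : i ∉ T) (f : ι → ℕ → R) (k : ℕ) :
    ∑ κ ∈ (Finset.cons i T hi).piAntidiag k, ∏ j ∈ Finset.cons i T hi, f j (κ j) =
      ∑ p ∈ Finset.HasAntidiagonal.antidiagonal k, f i p.1 * ∑ κ ∈ T.piAntidiag p.2, ∏ j ∈ T, f j (κ j) := by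
  rw [Finset.piAntidiag_cons, Finset.sum_disjiUnion]
  refine Finset.sum_congr rfl fun p _ => ?_
  rw [Finset.sum_map, Finset.mul_sum]
  refine Finset.sum_congr rfl fun κ hκ => ?_
  have h0 : κ i = 0 := by
    by_contra h
    exact hi ((Finset.mem_piAntidiag.1 hκ).2 i h)
  rw [Finset.prod_cons]
  simp only [addRightEmbedding_apply, Pi.add_apply, if_true, h0, zero_add]
  congr 1
  refine Finset.prod_congr rfl fun j hj => ?_
  have : j ≠ i := fun h => hi (h ▸ hj)
  simp [this]

/-- Cauchy products of finitely many absolutely convergent series. -/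
lemma hasSum_piAntidiag_prod {ι R : Type*} [DecidableEq ι] [NormedCommRing R] [CompleteSpace R]
    (T : Finset ι) (f : ι → ℕ → R) (hf : ∀ i ∈ T, Summable fun k => ‖f i k‖) :
    (Summable fun k => ‖∑ κ ∈ T.piAntidiag k, ∏ j ∈ T, f j (κ j)‖) ∧
      HasSum (fun k => ∑ κ ∈ T.piAntidiag k, ∏ j ∈ T, f j (κ j)) (∏ j ∈ T, ∑' k, f j k) := by
  induction T using Finset.cons_induction with
  | empty =>
    have h : ∀ k, k ≠ 0 → ∑ κ ∈ (∅ : Finset ι).piAntidiag k, ∏ j ∈ (∅ : Finset ι), f j (κ j) = 0 :=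
      fun k hk => by simp [hk]
    refine ⟨summable_of_ne_finset_zero (s := {0}) fun k hk => ?_, ?_⟩
    · rw [h k (by simpa using hk), norm_zero]
    · convert hasSum_single 0 h using 1
      simp
  | cons i T hi ih =>
    obtain ⟨h1, h2⟩ := ih fun j hj => hf j (Finset.mem_cons_of_mem hj)
    have h3 := hf i (Finset.mem_cons_self i T)
    simp only [Finset.sum_piAntidiag_cons_prod hi]
    have h4 := summable_norm_sum_mul_antidiagonal_of_summable_norm h3 h1
    refine ⟨h4, ?_⟩
    rw [Finset.prod_cons, ← h2.tsum_eq,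
      tsum_mul_tsum_eq_tsum_sum_antidiagonal_of_summable_norm h3 h1]
    exact h4.of_norm.hasSum

/-! ### The reproducing formula on the polydisc -/

lemma isProbabilityMeasure_weightedVolume (n : ℕ) {β : ℝ} (hβ : -1 < β) :
    IsProbabilityMeasure (weightedVolume n β) := by
  have := isProbabilityMeasure_weightedDiscArea hβ
  unfold weightedVolume
  infer_instance

lemma ae_mem_polydisc (n : ℕ) {β : ℝ} (hβ : -1 < β) :
    ∀ᵐ z ∂(weightedVolume n β), z ∈ polydisc n := by
  have := isProbabilityMeasure_weightedDiscArea hβ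
  refine eventually_all.2 fun j => ?_
  have h : ∀ᵐ z ∂(weightedDiscArea β), ‖z‖ < 1 :=
    (ae_mem_ball_weightedDiscArea β).mono fun z hz => by simpa using hz
  exact (Measure.tendsto_eval_ae_ae (μ := fun _ : Fin n => weightedDiscArea β)
    (i := j)).eventually h

lemma isOpen_polydisc (n : ℕ) : IsOpen (polydisc n) := by
  simp only [polydisc, Set.ofPred_forall]
  exact isOpen_iInter_of_finite fun j => isOpen_lt (by fun_prop) continuous_const

lemma ContinuousOn.aestronglyMeasurable_weightedVolume {n : ℕ} {β : ℝ} (hβ : -1 < β)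
    {F : (Fin n → ℂ) → ℂ} (hF : ContinuousOn F (polydisc n)) :
    AEStronglyMeasurable F (weightedVolume n β) := by
  have := hF.aestronglyMeasurable (μ := weightedVolume n β) (isOpen_polydisc n).measurableSet
  rwa [Measure.restrict_eq_self_of_ae_mem (ae_mem_polydisc n hβ)] at this

lemma continuousOn_prod_discKernel {n : ℕ} {β : ℝ} (hβ : -1 < β) {w : Fin n → ℂ}
    (hw : w ∈ polydisc n) :
    ContinuousOn (fun z : Fin n → ℂ => ∏ j, discKernel β (w j * conj (z j))) (polydisc n) := by
  refine continuousOn_finsetProd _ fun j _ => ?_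
  exact (continuousOn_discKernel hβ (hw j)).comp (continuous_apply j).continuousOn
    fun z hz => by simpa using hz j

lemma norm_prod_discKernel_le {n : ℕ} {β : ℝ} (hβ : -1 < β) {w z : Fin n → ℂ}
    (hw : w ∈ polydisc n) (hz : z ∈ polydisc n) :
    ‖∏ j, discKernel β (w j * conj (z j))‖ ≤ ∏ j, ∑' k, ‖w j‖ ^ k / discMoment β k := by
  rw [norm_prod]
  exact Finset.prod_le_prod (fun _ _ => norm_nonneg _) fun j _ => norm_discKernel_le hβ (hw j) (hz j)

lemma cons_mem_polydisc {n : ℕ} {x : ℂ} {z : Fin n → ℂ} :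
    (Fin.cons x z : Fin (n + 1) → ℂ) ∈ polydisc (n + 1) ↔ ‖x‖ < 1 ∧ z ∈ polydisc n := by
  simp [polydisc, Fin.forall_fin_succ]

/-- Integration against the product kernel evaluates integrable holomorphic functions on the
polydisc. The class of integrable functions is stable under freezing one variable, which allows
an induction on the number of variables. -/
theorem integral_mul_prod_discKernel {β : ℝ} (hβ : -1 < β) {n : ℕ} {F : (Fin n → ℂ) → ℂ}
    (hF : DifferentiableOn ℂ F (polydisc n)) (hi : Integrable F (weightedVolume n β))
    {w : Fin n → ℂ} (hw : w ∈ polydisc n) :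
    ∫ z, F z * ∏ j, discKernel β (w j * conj (z j)) ∂(weightedVolume n β) = F w := by
  have hP := isProbabilityMeasure_weightedDiscArea hβ
  induction n with
  | zero =>
    have hPv := isProbabilityMeasure_weightedVolume 0 hβ
    have : ∀ z, z = w := fun z => Subsingleton.elim _ _
    simp [this]
  | succ n ih =>
    have hPv := isProbabilityMeasure_weightedVolume n hβ
    have mp := (measurePreserving_piFinSuccAbove (fun _ : Fin (n + 1) => weightedDiscArea β) 0).symm
    have he : ∀ p : ℂ × (Fin n → ℂ), (MeasurableEquiv.piFinSuccAbove
        (fun _ : Fin (n + 1) => ℂ) 0).symm p = Fin.cons p.1 p.2 := fun p => by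
      simp [MeasurableEquiv.piFinSuccAbove, Fin.insertNthEquiv]
    have hw' := hw
    rw [← Fin.cons_self_tail w, cons_mem_polydisc] at hw'
    obtain ⟨hw0, hwt⟩ := hw'
    change MeasurePreserving _ ((weightedDiscArea β).prod (weightedVolume n β))
      (weightedVolume (n + 1) β) at mp
    have hi' : Integrable (fun p : ℂ × (Fin n → ℂ) => F (Fin.cons p.1 p.2))
        ((weightedDiscArea β).prod (weightedVolume n β)) := by
      have := (mp.integrable_comp_emb (MeasurableEquiv.measurableEmbedding _)).2 hi
      simpa only [Function.comp_def, he] using this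
    have hk0 : AEStronglyMeasurable (fun x => discKernel β (w 0 * conj x)) (weightedDiscArea β) := by
      have := (continuousOn_discKernel hβ hw0).aestronglyMeasurable (μ := weightedDiscArea β)
        measurableSet_ball
      rwa [Measure.restrict_eq_self_of_ae_mem (ae_mem_ball_weightedDiscArea β)] at this
    have hkt := (continuousOn_prod_discKernel hβ hwt).aestronglyMeasurable_weightedVolume hβ
    have hQ : Integrable (fun p : ℂ × (Fin n → ℂ) => F (Fin.cons p.1 p.2) *
        discKernel β (w 0 * conj p.1)) ((weightedDiscArea β).prod (weightedVolume n β)) := by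
      refine hi'.mul_bdd (c := ∑' k, ‖w 0‖ ^ k / discMoment β k) hk0.comp_fst ?_
      filter_upwards [Measure.quasiMeasurePreserving_fst.ae (ae_mem_ball_weightedDiscArea β)]
        with p hp
      exact norm_discKernel_le hβ hw0 (by simpa using hp)
    have hR : Integrable (fun p : ℂ × (Fin n → ℂ) => F (Fin.cons p.1 p.2) *
        discKernel β (w 0 * conj p.1) * ∏ j, discKernel β (Fin.tail w j * conj (p.2 j)))
        ((weightedDiscArea β).prod (weightedVolume n β)) := by
      refine hQ.mul_bdd (c := ∏ j, ∑' k, ‖Fin.tail w j‖ ^ k / discMoment β k) hkt.comp_snd ?_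
      filter_upwards [Measure.quasiMeasurePreserving_snd.ae (ae_mem_polydisc n hβ)] with p hp
      exact norm_prod_discKernel_le hβ hwt hp
    have hdiff : ∀ z ∈ polydisc n, DifferentiableOn ℂ (fun x : ℂ => F (Fin.cons x z))
        (Metric.ball 0 1) := fun z hz => by
      refine hF.comp (t := polydisc (n + 1)) ?_ fun x hx =>
        cons_mem_polydisc.2 ⟨by simpa using hx, hz⟩
      refine differentiableOn_pi.2 fun j => ?_
      refine Fin.cases ?_ (fun i => ?_) j
      · simp only [Fin.cons_zero]
        fun_prop
      · simp
    have hslice : ∀ᵐ z ∂(weightedVolume n β), ∫ x, F (Fin.cons x z) *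
        discKernel β (w 0 * conj x) ∂(weightedDiscArea β) = F (Fin.cons (w 0) z) := by
      filter_upwards [hi'.prod_left_ae, ae_mem_polydisc n hβ] with z hz1 hz2
      exact integral_mul_discKernel hβ (hdiff z hz2) hz1 hw0
    have hFt : DifferentiableOn ℂ (fun z : Fin n → ℂ => F (Fin.cons (w 0) z)) (polydisc n) := by
      refine hF.comp (t := polydisc (n + 1)) ?_ fun x hx => cons_mem_polydisc.2 ⟨hw0, hx⟩
      refine differentiableOn_pi.2 fun j => ?_
      refine Fin.cases ?_ (fun i => ?_) j
      · simp
      · simp only [Fin.cons_succ]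
        fun_prop
    have hIt : Integrable (fun z : Fin n → ℂ => F (Fin.cons (w 0) z)) (weightedVolume n β) :=
      hQ.integral_prod_right.congr hslice
    have key := ih hFt hIt hwt
    rw [← mp.integral_comp (MeasurableEquiv.measurableEmbedding _)]
    simp only [he, Fin.prod_univ_succ, Fin.cons_zero, Fin.cons_succ, ← mul_assoc]
    change ∫ p : ℂ × (Fin n → ℂ), F (Fin.cons p.1 p.2) *
        discKernel β (w 0 * conj p.1) * ∏ j, discKernel β (Fin.tail w j * conj (p.2 j))
        ∂((weightedDiscArea β).prod (weightedVolume n β)) = _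
    rw [integral_prod_symm _ hR]
    simp only [integral_mul_const]
    rw [Fin.cons_self_tail] at key
    rw [← key]
    refine integral_congr_ae ?_
    filter_upwards [hslice] with z hz
    rw [hz]

/-! ### Orthogonal sequences in an inner product space -/

lemma norm_sq_sum_smul_of_orthogonal {E ι : Type*} [NormedAddCommGroup E] [InnerProductSpace ℂ E]
    {v : ι → E} (hv : ∀ k l, k ≠ l → inner ℂ (v k) (v l) = 0) (s : Finset ι) (c : ι → ℂ) :
    ‖∑ k ∈ s, c k • v k‖ ^ 2 = ∑ k ∈ s, ‖c k‖ ^ 2 * ‖v k‖ ^ 2 := by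
  classical
  have h : (inner ℂ (∑ k ∈ s, c k • v k) (∑ k ∈ s, c k • v k) : ℂ) =
      ∑ k ∈ s, (((‖c k‖ ^ 2 * ‖v k‖ ^ 2 : ℝ)) : ℂ) := by
    rw [sum_inner]
    refine Finset.sum_congr rfl fun k hk => ?_
    rw [inner_sum, Finset.sum_eq_single k]
    · rw [inner_smul_left, inner_smul_right, inner_self_eq_norm_sq_to_K, ← mul_assoc,
        ← Complex.normSq_eq_conj_mul_self, Complex.normSq_eq_norm_sq]
      push_cast
      rfl
    · intro l _ hl
      rw [inner_smul_left, inner_smul_right, hv k l hl.symm]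
      simp
    · exact fun h => absurd hk h
  rw [inner_self_eq_norm_sq_to_K, ← Complex.ofReal_sum] at h
  apply Complex.ofReal_injective
  rw [Complex.ofReal_pow]
  exact h

/-- Bessel's inequality for an orthogonal, not necessarily normalized, family; the terms of
index `k` with `v k = 0` are zero by the convention `x / 0 = 0`. -/
lemma sum_norm_inner_sq_div_le {E ι : Type*} [NormedAddCommGroup E] [InnerProductSpace ℂ E]
    {v : ι → E} (hv : ∀ k l, k ≠ l → inner ℂ (v k) (v l) = 0) (s : Finset ι) (x : E) :
    ∑ k ∈ s, ‖(inner ℂ (v k) x : ℂ)‖ ^ 2 / ‖v k‖ ^ 2 ≤ ‖x‖ ^ 2 := by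
  set c : ι → ℂ := fun k => inner ℂ (v k) x / (‖v k‖ ^ 2 : ℝ) with hc
  set B := ∑ k ∈ s, ‖(inner ℂ (v k) x : ℂ)‖ ^ 2 / ‖v k‖ ^ 2 with hB
  have h1 : ‖∑ k ∈ s, c k • v k‖ ^ 2 = B := by
    rw [norm_sq_sum_smul_of_orthogonal hv]
    refine Finset.sum_congr rfl fun k _ => ?_
    rw [hc]
    simp only [norm_div, Complex.norm_real, norm_pow, norm_norm]
    by_cases h0 : ‖v k‖ = 0
    · simp [h0]
    · field_simp
  have h2 : (inner ℂ (∑ k ∈ s, c k • v k) x : ℂ) = (B : ℂ) := by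
    rw [sum_inner, hB, Complex.ofReal_sum]
    refine Finset.sum_congr rfl fun k _ => ?_
    rw [inner_smul_left, hc]
    simp only [map_div₀, Complex.conj_ofReal]
    rw [div_mul_eq_mul_div, ← Complex.normSq_eq_conj_mul_self, Complex.normSq_eq_norm_sq]
    push_cast
    rfl
  have h3 := norm_inner_le_norm (𝕜 := ℂ) (∑ k ∈ s, c k • v k) x
  have hB0 : 0 ≤ B := h1 ▸ sq_nonneg _
  rw [h2, Complex.norm_real, Real.norm_of_nonneg hB0] at h3
  have h4 : B ^ 2 ≤ B * ‖x‖ ^ 2 := by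
    calc B ^ 2 ≤ (‖∑ k ∈ s, c k • v k‖ * ‖x‖) ^ 2 := by gcongr
      _ = _ := by rw [mul_pow, h1]
  rcases hB0.eq_or_lt with h | h
  · rw [← h]
    positivity
  · nlinarith

/-! ### The Hilbert space structure -/

lemma bergmanNorm_eq_eLpNorm (n : ℕ) (β : ℝ) (F : (Fin n → ℂ) → ℂ) :
    bergmanNorm n β F = eLpNorm F 2 (weightedVolume n β) := by
  rw [bergmanNorm, eLpNorm_eq_lintegral_rpow_enorm_toReal (by norm_num) (by norm_num)]
  norm_num

lemma inner_toLp {X : Type*} [MeasurableSpace X] {μ : Measure X} {f g : X → ℂ}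
    (hf : MemLp f 2 μ) (hg : MemLp g 2 μ) :
    (inner ℂ (hf.toLp f) (hg.toLp g) : ℂ) = ∫ x, g x * conj (f x) ∂μ := by
  rw [L2.inner_def]
  refine integral_congr_ae ?_
  filter_upwards [hf.coeFn_toLp, hg.coeFn_toLp] with x h1 h2
  rw [h1, h2]
  rfl

lemma norm_toLp_sq {X : Type*} [MeasurableSpace X] {μ : Measure X} {f : X → ℂ}
    (hf : MemLp f 2 μ) : ‖hf.toLp f‖ ^ 2 = ∫ x, ‖f x‖ ^ 2 ∂μ := by
  have h := inner_toLp hf hf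
  simp only [inner_self_eq_norm_sq_to_K, Complex.mul_conj, Complex.normSq_eq_norm_sq] at h
  rw [integral_complex_ofReal] at h
  apply Complex.ofReal_injective
  rw [Complex.ofReal_pow]
  exact h

lemma Continuous.memLp_weightedVolume {n : ℕ} {β : ℝ} (hβ : -1 < β) {f : (Fin n → ℂ) → ℂ}
    (hf : Continuous f) : MemLp f 2 (weightedVolume n β) := by
  have := isProbabilityMeasure_weightedVolume n hβ
  obtain ⟨C, hC⟩ := (isCompact_closedBall (0 : Fin n → ℂ) 1).exists_bound_of_continuousOn
    hf.continuousOn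
  refine MemLp.of_bound hf.aestronglyMeasurable C ?_
  filter_upwards [ae_mem_polydisc n hβ] with z hz
  refine hC z ?_
  rw [mem_closedBall_zero_iff, pi_norm_le_iff_of_nonneg zero_le_one]
  exact fun j => (hz j).le

lemma memLp_of_mem_bergmanSpace {n : ℕ} {β : ℝ} (hβ : -1 < β) {F : (Fin n → ℂ) → ℂ}
    (hF : F ∈ bergmanSpace n β) : MemLp F 2 (weightedVolume n β) :=
  ⟨hF.1.continuousOn.aestronglyMeasurable_weightedVolume hβ, by
    rw [← bergmanNorm_eq_eLpNorm]; exact hF.2⟩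

lemma Differentiable.mem_bergmanSpace {n : ℕ} {β : ℝ} (hβ : -1 < β) {f : (Fin n → ℂ) → ℂ}
    (hf : Differentiable ℂ f) : f ∈ bergmanSpace n β :=
  ⟨hf.differentiableOn, by
    rw [bergmanNorm_eq_eLpNorm]; exact (hf.continuous.memLp_weightedVolume hβ).2⟩

lemma bergmanNorm_eq_ofReal {n : ℕ} {β : ℝ} {f : (Fin n → ℂ) → ℂ}
    (hf : MemLp f 2 (weightedVolume n β)) : bergmanNorm n β f = ENNReal.ofReal ‖hf.toLp f‖ := by
  rw [bergmanNorm_eq_eLpNorm, Lp.norm_toLp, ENNReal.ofReal_toReal hf.2.ne]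

/-! ### Monomials -/

/-- The monomial `z^κ`. -/
def monomialFun {n : ℕ} (κ : Fin n → ℕ) (z : Fin n → ℂ) : ℂ := ∏ j, z j ^ κ j

/-- The square of the norm of the monomial `z^κ` in `A²_β(𝔻ⁿ)`. -/
def monomialNormSq {n : ℕ} (β : ℝ) (κ : Fin n → ℕ) : ℝ := ∏ j, discMoment β (κ j)

lemma monomialNormSq_pos {n : ℕ} {β : ℝ} (hβ : -1 < β) (κ : Fin n → ℕ) :
    0 < monomialNormSq β κ := Finset.prod_pos fun _ _ => discMoment_pos hβ _

lemma differentiable_monomialFun {n : ℕ} (κ : Fin n → ℕ) : Differentiable ℂ (monomialFun κ) := by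
  unfold monomialFun
  fun_prop

lemma integral_monomialFun_mul_conj {n : ℕ} {β : ℝ} (hβ : -1 < β) (κ l : Fin n → ℕ) :
    ∫ z, monomialFun κ z * conj (monomialFun l z) ∂(weightedVolume n β) =
      if κ = l then (monomialNormSq β κ : ℂ) else 0 := by
  have := isProbabilityMeasure_weightedDiscArea hβ
  simp only [monomialFun, map_prod, map_pow, ← Finset.prod_mul_distrib]
  rw [weightedVolume, integral_fintype_prod_eq_prod
    (f := fun j (x : ℂ) => x ^ κ j * conj x ^ l j)]
  simp only [integral_pow_mul_conj_pow]
  split_ifs with h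
  · subst h
    simp [monomialNormSq]
  · obtain ⟨j, hj⟩ := Function.ne_iff.1 h
    exact Finset.prod_eq_zero (Finset.mem_univ j) (if_neg hj)

lemma integral_sum_monomialFun_mul_conj {n : ℕ} {β : ℝ} (hβ : -1 < β) {ι : Type*}
    (e : ι → Fin n → ℕ) (S T : Finset ι) (c d : ι → ℂ) :
    ∫ z, (∑ i ∈ S, c i * monomialFun (e i) z) * conj (∑ l ∈ T, d l * monomialFun (e l) z)
      ∂(weightedVolume n β) =
      ∑ i ∈ S, ∑ l ∈ T, if e i = e l then c i * conj (d l) * (monomialNormSq β (e i) : ℂ) else 0 := by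
  have hint : ∀ κ l : Fin n → ℕ, Integrable (fun z => monomialFun κ z * conj (monomialFun l z))
      (weightedVolume n β) := fun κ l => by
    have := isProbabilityMeasure_weightedVolume n hβ
    refine MemLp.integrable (q := 2) (by norm_num) (Continuous.memLp_weightedVolume hβ ?_)
    have h1 := (differentiable_monomialFun κ).continuous
    have h2 := (differentiable_monomialFun l).continuous
    fun_prop
  have h : ∀ z : Fin n → ℂ, (∑ i ∈ S, c i * monomialFun (e i) z) *
      conj (∑ l ∈ T, d l * monomialFun (e l) z) = ∑ i ∈ S, ∑ l ∈ T,
        c i * conj (d l) * (monomialFun (e i) z * conj (monomialFun (e l) z)) := fun z => by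
    rw [map_sum, Finset.sum_mul_sum]
    refine Finset.sum_congr rfl fun i _ => Finset.sum_congr rfl fun l _ => ?_
    rw [map_mul]
    ring
  simp only [h]
  rw [integral_finsetSum _ fun i _ => integrable_finsetSum _ fun l _ => (hint _ _).const_mul _]
  refine Finset.sum_congr rfl fun i _ => ?_
  rw [integral_finsetSum _ fun l _ => (hint _ _).const_mul _]
  refine Finset.sum_congr rfl fun l _ => ?_
  rw [integral_const_mul, integral_monomialFun_mul_conj hβ]
  split_ifs <;> simp

/-- The squared norm of a polynomial, given as a linear combination of distinct monomials. -/
lemma integral_norm_sq_sum_monomialFun {n : ℕ} {β : ℝ} (hβ : -1 < β) {ι : Type*}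
    {e : ι → Fin n → ℕ} (he : Function.Injective e) (S : Finset ι) (c : ι → ℂ) :
    ∫ z, ‖∑ i ∈ S, c i * monomialFun (e i) z‖ ^ 2 ∂(weightedVolume n β) =
      ∑ i ∈ S, ‖c i‖ ^ 2 * monomialNormSq β (e i) := by
  classical
  have h := integral_sum_monomialFun_mul_conj hβ e S S c c
  simp only [Complex.mul_conj, Complex.normSq_eq_norm_sq] at h
  rw [integral_complex_ofReal] at h
  apply Complex.ofReal_injective
  rw [h, Complex.ofReal_sum]
  refine Finset.sum_congr rfl fun i hi => ?_
  simp only [he.eq_iff]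
  rw [Finset.sum_ite_eq, if_pos hi, Complex.mul_conj, Complex.normSq_eq_norm_sq, Complex.ofReal_mul]

/-! ### Restriction to the diagonal -/

/-- The indices of the coordinates that are not the last one. -/
def nonLast (n : ℕ) : Finset (Fin n) := {j | (j : ℕ) + 1 ≠ n}

/-- The homogeneous polynomial that represents the `k`-th Taylor coefficient of
`t ↦ F (t, …, t, 0)`. -/
def diagKernel (n : ℕ) (β : ℝ) (k : ℕ) (z : Fin n → ℂ) : ℂ :=
  ∑ κ ∈ (nonLast n).piAntidiag k, ((monomialNormSq β κ)⁻¹ : ℂ) * monomialFun κ z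

/-- The squared norm of `diagKernel`. -/
def diagKernelNormSq (n : ℕ) (β : ℝ) (k : ℕ) : ℝ :=
  ∑ κ ∈ (nonLast n).piAntidiag k, (monomialNormSq β κ)⁻¹

lemma diagKernelNormSq_nonneg (n : ℕ) {β : ℝ} (hβ : -1 < β) (k : ℕ) :
    0 ≤ diagKernelNormSq n β k :=
  Finset.sum_nonneg fun κ _ => (inv_pos.2 (monomialNormSq_pos hβ κ)).le

lemma differentiable_diagKernel (n : ℕ) (β : ℝ) (k : ℕ) : Differentiable ℂ (diagKernel n β k) := by
  unfold diagKernel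
  exact Differentiable.fun_sum fun κ _ => (differentiable_monomialFun κ).const_mul _

lemma integral_diagKernel_mul_conj (n : ℕ) {β : ℝ} (hβ : -1 < β) {k l : ℕ} (h : k ≠ l) :
    ∫ z, diagKernel n β l z * conj (diagKernel n β k z) ∂(weightedVolume n β) = 0 := by
  unfold diagKernel
  rw [integral_sum_monomialFun_mul_conj hβ (fun κ => κ) _ _ (fun κ => ((monomialNormSq β κ)⁻¹ : ℂ))
    (fun κ => ((monomialNormSq β κ)⁻¹ : ℂ))]
  refine Finset.sum_eq_zero fun κ hκ => Finset.sum_eq_zero fun l' hl' => if_neg ?_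
  rintro rfl
  exact h ((Finset.mem_piAntidiag.1 hl').1.symm.trans (Finset.mem_piAntidiag.1 hκ).1)

lemma integral_norm_sq_diagKernel (n : ℕ) {β : ℝ} (hβ : -1 < β) (k : ℕ) :
    ∫ z, ‖diagKernel n β k z‖ ^ 2 ∂(weightedVolume n β) = diagKernelNormSq n β k := by
  unfold diagKernel
  rw [integral_norm_sq_sum_monomialFun hβ (e := fun κ => κ) (fun _ _ h => h) _ (fun κ => ((monomialNormSq β κ)⁻¹ : ℂ))]
  refine Finset.sum_congr rfl fun κ _ => ?_
  have := monomialNormSq_pos hβ κ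
  rw [norm_inv, Complex.norm_real, Real.norm_of_nonneg this.le]
  field_simp

lemma prod_nonLast_eq {R : Type*} [CommMonoid R] {n k : ℕ} {κ : Fin n → ℕ}
    (hκ : κ ∈ (nonLast n).piAntidiag k) {f : Fin n → ℕ → R} (hf : ∀ j, f j 0 = 1) :
    ∏ j ∈ nonLast n, f j (κ j) = ∏ j, f j (κ j) := by
  refine Finset.prod_subset (Finset.subset_univ _) fun j _ hj => ?_
  have : κ j = 0 := by
    by_contra h
    exact hj ((Finset.mem_piAntidiag.1 hκ).2 j h)
  rw [this, hf]

/-- The value of a monomial at a point of the diagonal. -/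
lemma monomialFun_diag {n k : ℕ} {κ : Fin n → ℕ} (hκ : κ ∈ (nonLast n).piAntidiag k) (t : ℂ) :
    monomialFun κ (fun j => if (j : ℕ) + 1 = n then 0 else t) = t ^ k := by
  unfold monomialFun
  rw [← prod_nonLast_eq (f := fun (j : Fin n) i => (if (j : ℕ) + 1 = n then 0 else t) ^ i) hκ
    (fun _ => pow_zero _), ← (Finset.mem_piAntidiag.1 hκ).1, ← Finset.prod_pow_eq_pow_sum]
  refine Finset.prod_congr rfl fun j hj => ?_
  rw [if_neg (by simpa [nonLast] using hj)]

lemma diagKernel_diag (n : ℕ) (β : ℝ) (k : ℕ) (t : ℂ) :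
    diagKernel n β k (fun j => if (j : ℕ) + 1 = n then 0 else t) =
      diagKernelNormSq n β k * t ^ k := by
  rw [diagKernel, diagKernelNormSq, Complex.ofReal_sum, Finset.sum_mul]
  refine Finset.sum_congr rfl fun κ hκ => ?_
  rw [monomialFun_diag hκ]
  push_cast
  rfl

lemma norm_diagKernel_le (n : ℕ) {β : ℝ} (hβ : -1 < β) (k : ℕ) {z : Fin n → ℂ}
    (hz : z ∈ polydisc n) : ‖diagKernel n β k z‖ ≤ diagKernelNormSq n β k := by
  refine (norm_sum_le _ _).trans (Finset.sum_le_sum fun κ _ => ?_)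
  have h := monomialNormSq_pos hβ κ
  rw [norm_mul, norm_inv, Complex.norm_real, Real.norm_of_nonneg h.le, monomialFun, norm_prod]
  refine mul_le_of_le_one_right (inv_pos.2 h).le ?_
  refine Finset.prod_le_one (fun _ _ => norm_nonneg _) fun j _ => ?_
  rw [norm_pow]
  exact pow_le_one₀ (norm_nonneg _) (hz j).le

lemma summable_diagKernelNormSq (n : ℕ) {β : ℝ} (hβ : -1 < β) {x : ℝ} (hx0 : 0 ≤ x)
    (hx : x < 1) : Summable fun k => x ^ k * diagKernelNormSq n β k := by
  have h0 : ∀ k, 0 ≤ x ^ k / discMoment β k := fun k =>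
    div_nonneg (by positivity) (discMoment_pos hβ k).le
  have h := (hasSum_piAntidiag_prod (nonLast n) (fun _ k => x ^ k / discMoment β k) fun _ _ => by
    simpa only [Real.norm_of_nonneg (h0 _)] using summable_pow_div_discMoment hβ hx0 hx).2.summable
  refine h.congr fun k => ?_
  rw [diagKernelNormSq, Finset.mul_sum]
  refine Finset.sum_congr rfl fun κ hκ => ?_
  rw [Finset.prod_div_distrib, Finset.prod_pow_eq_pow_sum, (Finset.mem_piAntidiag.1 hκ).1,
    monomialNormSq, prod_nonLast_eq (f := fun _ k => discMoment β k) hκ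
      (fun _ => discMoment_zero hβ), div_eq_mul_inv]

lemma hasSum_prod_discKernel_diag (n : ℕ) {β : ℝ} (hβ : -1 < β) {t : ℂ} (ht : ‖t‖ < 1)
    {z : Fin n → ℂ} (hz : z ∈ polydisc n) :
    HasSum (fun k => t ^ k * conj (diagKernel n β k z))
      (∏ j : Fin n, discKernel β ((if (j : ℕ) + 1 = n then 0 else t) * conj (z j))) := by
  have h := (hasSum_piAntidiag_prod (nonLast n)
    (fun j k => (t * conj (z j)) ^ k / (discMoment β k : ℂ)) fun j _ =>
      (summable_pow_div_discMoment hβ (norm_nonneg t) ht).of_nonneg_of_le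
        (fun _ => norm_nonneg _) fun k => norm_kernel_term_le hβ t (hz j) k).2
  have he : ∏ j : Fin n, discKernel β ((if (j : ℕ) + 1 = n then 0 else t) * conj (z j)) =
      ∏ j ∈ nonLast n, ∑' k, (t * conj (z j)) ^ k / (discMoment β k : ℂ) := by
    rw [← Finset.prod_subset (Finset.subset_univ (nonLast n))]
    · refine Finset.prod_congr rfl fun j hj => ?_
      rw [if_neg (by simpa [nonLast] using hj)]
      rfl
    · intro j _ hj
      rw [if_pos (by simpa [nonLast] using hj), zero_mul, discKernel_zero hβ]
  rw [he]
  refine h.congr_fun fun k => ?_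
  rw [diagKernel, map_sum, Finset.mul_sum]
  refine Finset.sum_congr rfl fun κ hκ => ?_
  rw [Finset.prod_div_distrib]
  simp only [mul_pow]
  rw [Finset.prod_mul_distrib, Finset.prod_pow_eq_pow_sum, (Finset.mem_piAntidiag.1 hκ).1,
    prod_nonLast_eq (f := fun _ k => (discMoment β k : ℂ)) hκ
      (fun _ => by simp [discMoment_zero hβ]),
    prod_nonLast_eq (f := fun j k => conj (z j) ^ k) hκ (fun _ => pow_zero _)]
  simp only [monomialNormSq, monomialFun, map_mul, map_inv₀, Complex.conj_ofReal, map_prod,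
    map_pow, Complex.ofReal_prod]
  ring

/-- The power series of the restriction of `F` to the diagonal `(t, …, t, 0)`. -/
lemma hasSum_diag (n : ℕ) {β : ℝ} (hβ : -1 < β) {F : (Fin n → ℂ) → ℂ}
    (hF : DifferentiableOn ℂ F (polydisc n)) (hi : Integrable F (weightedVolume n β))
    {t : ℂ} (ht : ‖t‖ < 1) :
    HasSum (fun k => (∫ z, F z * conj (diagKernel n β k z) ∂(weightedVolume n β)) * t ^ k)
      (F fun j => if (j : ℕ) + 1 = n then 0 else t) := by
  have hw : (fun j : Fin n => if (j : ℕ) + 1 = n then 0 else t) ∈ polydisc n := fun j => by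
    dsimp only
    split_ifs <;> simp [ht]
  rw [← integral_mul_prod_discKernel hβ hF hi hw]
  have hbd : ∀ k : ℕ, ∀ᵐ z ∂(weightedVolume n β), ‖t ^ k * conj (diagKernel n β k z)‖ ≤
      ‖t‖ ^ k * diagKernelNormSq n β k := fun k => by
    filter_upwards [ae_mem_polydisc n hβ] with z hz
    rw [norm_mul, norm_pow, RCLike.norm_conj]
    gcongr
    exact norm_diagKernel_le n hβ k hz
  have hint : ∀ k : ℕ, Integrable (fun z => F z * (t ^ k * conj (diagKernel n β k z)))
      (weightedVolume n β) := fun k => by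
    refine hi.mul_bdd (Continuous.aestronglyMeasurable ?_) (hbd k)
    have := (differentiable_diagKernel n β k).continuous
    fun_prop
  have h1 := hasSum_integral_of_summable_integral_norm hint
    (Summable.of_nonneg_of_le (fun k => integral_nonneg fun _ => norm_nonneg _) (fun k => by
      calc _ ≤ ∫ z, ‖F z‖ * (‖t‖ ^ k * diagKernelNormSq n β k) ∂(weightedVolume n β) := by
            refine integral_mono_ae (hint k).norm (hi.norm.mul_const _) ?_
            filter_upwards [hbd k] with z hz
            rw [norm_mul]
            gcongr
        _ = _ := integral_mul_const _ _)
      ((summable_diagKernelNormSq n hβ (norm_nonneg t) ht).mul_left _))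
  have he : ∫ z, F z * ∏ j : Fin n, discKernel β ((if (j : ℕ) + 1 = n then 0 else t) * conj (z j))
      ∂(weightedVolume n β) =
      ∫ z, ∑' k, F z * (t ^ k * conj (diagKernel n β k z)) ∂(weightedVolume n β) := by
    refine integral_congr_ae ?_
    filter_upwards [ae_mem_polydisc n hβ] with z hz
    rw [tsum_mul_left, (hasSum_prod_discKernel_diag n hβ ht hz).tsum_eq]
  rw [he]
  refine h1.congr_fun fun k => ?_
  rw [mul_comm, ← integral_const_mul]
  congr 1 with z
  ring

/-! ### The boundedness criterion -/

/-- The squared norms `∫ |φ^k|² dV_β` of the powers of the symbol. -/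
def symbolMoment (n : ℕ) (β : ℝ) (φ : (Fin n → ℂ) → ℂ) (k : ℕ) : ℝ :=
  ∫ z, ‖φ z ^ k‖ ^ 2 ∂(weightedVolume n β)

lemma measurePreserving_rotate_weightedVolume (n : ℕ) {β : ℝ} (hβ : -1 < β) {c : ℂ}
    (hc : ‖c‖ = 1) : MeasurePreserving (fun (z : Fin n → ℂ) j => c * z j)
      (weightedVolume n β) (weightedVolume n β) := by
  have := isProbabilityMeasure_weightedDiscArea hβ
  exact measurePreserving_pi _ _ fun _ => measurePreserving_mul_weightedDiscArea β hc

lemma integral_pow_mul_conj_pow_of_homogeneous {n : ℕ} {β : ℝ} (hβ : -1 < β)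
    {φ : (Fin n → ℂ) → ℂ} (hφ : Continuous φ) {d : ℕ} (hd : d ≠ 0)
    (hhom : ∀ c : ℂ, ‖c‖ = 1 → ∀ z, φ (fun j => c * z j) = c ^ d * φ z) {k l : ℕ} (h : k ≠ l) :
    ∫ z, φ z ^ l * conj (φ z ^ k) ∂(weightedVolume n β) = 0 := by
  have h' : d * l ≠ d * k := fun e => h (Nat.eq_of_mul_eq_mul_left (Nat.pos_of_ne_zero hd) e).symm
  obtain ⟨c, hc, hckl⟩ := exists_norm_eq_one_pow_mul_conj_pow_ne_one h'
  refine (measurePreserving_rotate_weightedVolume n hβ hc).integral_eq_zero_of_comp_eq_mul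
    (f := fun z => φ z ^ l * conj (φ z ^ k)) (Continuous.aestronglyMeasurable (by fun_prop))
    hckl fun z => ?_
  simp only [hhom c hc, mul_pow, map_mul, map_pow, pow_mul]
  ring

lemma toLp_sum_smul {X ι : Type*} [MeasurableSpace X] {μ : Measure X} {f : ι → X → ℂ}
    (hf : ∀ k, MemLp (f k) 2 μ) (c : ι → ℂ) (s : Finset ι)
    (h : MemLp (∑ k ∈ s, c k • f k) 2 μ) : h.toLp = ∑ k ∈ s, c k • (hf k).toLp := by
  induction s using Finset.cons_induction with
  | empty =>
    simp only [Finset.sum_empty]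
    exact MemLp.toLp_zero _
  | cons i s hi ih =>
    have hs : MemLp (∑ k ∈ s, c k • f k) 2 μ :=
      memLp_finsetSum' _ fun k _ => (hf k).const_smul _
    simp only [Finset.sum_cons]
    rw [MemLp.toLp_add ((hf i).const_smul (c i)) hs, MemLp.toLp_const_smul, ih hs]

lemma le_of_mul_sq_le {A N C : ℝ} (hA : 0 ≤ A) (h : A ^ 2 * N ≤ C ^ 2 * A) : A * N ≤ C ^ 2 := by
  rcases hA.eq_or_lt with rfl | hA
  · simpa using sq_nonneg C
  · refine le_of_mul_le_mul_left ?_ hA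
    linarith

/-- The composition operator is bounded exactly when the norms of the powers of the symbol are
controlled by the norms of the functionals "`k`-th Taylor coefficient on the diagonal". -/
theorem isBoundedCompOp_diagonalMap_iff {n : ℕ} {β : ℝ} (hβ : -1 < β) {φ : (Fin n → ℂ) → ℂ}
    (hφ : Differentiable ℂ φ) (hmap : Set.MapsTo φ (polydisc n) (Metric.ball 0 1)) {d : ℕ}
    (hd : d ≠ 0) (hhom : ∀ c : ℂ, ‖c‖ = 1 → ∀ z, φ (fun j => c * z j) = c ^ d * φ z) :
    IsBoundedCompOp n β (diagonalMap n φ) ↔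
      ∃ C : ℝ, ∀ k, diagKernelNormSq n β k * symbolMoment n β φ k ≤ C := by
  have hprob := isProbabilityMeasure_weightedVolume n hβ
  have hKm : ∀ k, MemLp (diagKernel n β k) 2 (weightedVolume n β) := fun k =>
    (differentiable_diagKernel n β k).continuous.memLp_weightedVolume hβ
  have hPm : ∀ k : ℕ, MemLp (fun z => φ z ^ k) 2 (weightedVolume n β) := fun k =>
    (hφ.continuous.pow k).memLp_weightedVolume hβ
  have hKn : ∀ k, ‖(hKm k).toLp‖ ^ 2 = diagKernelNormSq n β k := fun k => by
    rw [norm_toLp_sq, integral_norm_sq_diagKernel n hβ]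
  have hPn : ∀ k, ‖(hPm k).toLp‖ ^ 2 = symbolMoment n β φ k := fun k => norm_toLp_sq _
  have hA0 := diagKernelNormSq_nonneg n hβ
  constructor
  · rintro ⟨C, hC⟩
    refine ⟨(C : ℝ) ^ 2, fun k => le_of_mul_sq_le (hA0 k) ?_⟩
    obtain ⟨-, h⟩ := hC _ ((differentiable_diagKernel n β k).mem_bergmanSpace hβ)
    have hcomp : diagKernel n β k ∘ diagonalMap n φ =
        (diagKernelNormSq n β k : ℂ) • fun z => φ z ^ k := by
      ext z
      exact diagKernel_diag n β k (φ z)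
    rw [hcomp, bergmanNorm_eq_ofReal (hKm k), bergmanNorm_eq_ofReal ((hPm k).const_smul _),
      ← ENNReal.ofReal_coe_nnreal, ← ENNReal.ofReal_mul (NNReal.coe_nonneg C),
      ENNReal.ofReal_le_ofReal_iff (by positivity), MemLp.toLp_const_smul _ (hPm k), norm_smul,
      Complex.norm_real, Real.norm_of_nonneg (hA0 k)] at h
    calc diagKernelNormSq n β k ^ 2 * symbolMoment n β φ k
        = (diagKernelNormSq n β k * ‖(hPm k).toLp‖) ^ 2 := by rw [mul_pow, hPn]
      _ ≤ (C * ‖(hKm k).toLp‖) ^ 2 := by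
          have := hA0 k
          gcongr
      _ = _ := by rw [mul_pow, hKn]
  · rintro ⟨C, hC⟩
    have hC0 : 0 ≤ C := (mul_nonneg (hA0 0) (hPn 0 ▸ sq_nonneg _)).trans (hC 0)
    have hΦ := diagonalMap_mapsTo hmap
    suffices h : ∀ F ∈ bergmanSpace n β,
        bergmanNorm n β (F ∘ diagonalMap n φ) ≤ (NNReal.sqrt ⟨C, hC0⟩ : ℝ≥0) * bergmanNorm n β F by
      refine ⟨NNReal.sqrt ⟨C, hC0⟩, fun F hF => ⟨⟨?_, ?_⟩, h F hF⟩⟩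
      · exact hF.1.comp (diagonalMap_differentiableOn hφ.differentiableOn) hΦ
      · exact (h F hF).trans_lt (ENNReal.mul_lt_top ENNReal.coe_lt_top hF.2)
    intro F hF
    have hFm := memLp_of_mem_bergmanSpace hβ hF
    have hKo : ∀ k l, k ≠ l → inner ℂ ((hKm k).toLp) ((hKm l).toLp) = (0 : ℂ) := fun k l h => by
      rw [inner_toLp, integral_diagKernel_mul_conj n hβ h]
    have hPo : ∀ k l, k ≠ l → inner ℂ ((hPm k).toLp) ((hPm l).toLp) = (0 : ℂ) := fun k l h => by
      rw [inner_toLp, integral_pow_mul_conj_pow_of_homogeneous hβ hφ.continuous hd hhom h]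
    set g : ℕ → ℂ := fun k => ∫ z, F z * conj (diagKernel n β k z) ∂(weightedVolume n β) with hg
    have hgi : ∀ k, g k = inner ℂ ((hKm k).toLp) (hFm.toLp) := fun k => (inner_toLp _ _).symm
    have hsum : ∀ z ∈ polydisc n, HasSum (fun k => g k * φ z ^ k) (F (diagonalMap n φ z)) :=
      fun z hz => hasSum_diag n hβ hF.1 (hFm.integrable (by norm_num)) (by simpa using hmap hz)
    have hSm : ∀ N : ℕ, MemLp (∑ k ∈ Finset.range N, g k • fun z => φ z ^ k) 2
        (weightedVolume n β) := fun N => memLp_finsetSum' _ fun k _ => (hPm k).const_smul _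
    have hSn : ∀ N : ℕ, ‖(hSm N).toLp‖ ^ 2 ≤ C * ‖hFm.toLp‖ ^ 2 := fun N => by
      have h1 : (hSm N).toLp = ∑ k ∈ Finset.range N, g k • (hPm k).toLp :=
        toLp_sum_smul hPm g _ _
      rw [h1, norm_sq_sum_smul_of_orthogonal hPo]
      refine le_trans ?_ (mul_le_mul_of_nonneg_left
        (sum_norm_inner_sq_div_le hKo (Finset.range N) hFm.toLp) hC0)
      rw [Finset.mul_sum]
      refine Finset.sum_le_sum fun k _ => ?_
      rw [← hgi, hPn, hKn]
      rcases (hA0 k).eq_or_lt with h0 | h0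
      · have h2 : (hKm k).toLp = 0 := by
          rw [← norm_eq_zero, ← sq_eq_zero_iff, hKn, ← h0]
        rw [hgi, h2, inner_zero_left]
        simp
      · rw [mul_div_assoc', le_div_iff₀ h0]
        nlinarith [mul_le_mul_of_nonneg_left (hC k) (sq_nonneg ‖g k‖)]
    rw [bergmanNorm_eq_eLpNorm]
    refine (Lp.eLpNorm_lim_le_liminf_eLpNorm (fun N => (hSm N).1) _ ?_).trans ?_
    · filter_upwards [ae_mem_polydisc n hβ] with z hz
      simpa [Finset.sum_apply] using (hsum z hz).tendsto_sum_nat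
    · refine liminf_le_of_le (by isBoundedDefault) fun b hb => ?_
      obtain ⟨N, hN⟩ := hb.exists
      refine hN.trans ?_
      rw [← bergmanNorm_eq_eLpNorm, bergmanNorm_eq_ofReal (hSm N), bergmanNorm_eq_ofReal hFm,
        ← ENNReal.ofReal_coe_nnreal, ← ENNReal.ofReal_mul (NNReal.coe_nonneg _)]
      refine ENNReal.ofReal_le_ofReal (abs_le_of_sq_le_sq' ?_ (by positivity)).2
      rw [mul_pow]
      refine (hSn N).trans_eq ?_
      have h2 := congrArg NNReal.toReal (NNReal.sq_sqrt ⟨C, hC0⟩)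
      rw [NNReal.coe_pow] at h2
      rw [h2]
      rfl

/-! ### The norms of the diagonal functionals -/

lemma HasPowerOrder.sum_piAntidiag_prod {ι : Type*} [DecidableEq ι] {u : ℕ → ℝ} {p : ℝ}
    (hu : HasPowerOrder u p) (hp : 0 ≤ p) {T : Finset ι} (hT : T.Nonempty) :
    HasPowerOrder (fun k => ∑ κ ∈ T.piAntidiag k, ∏ j ∈ T, u (κ j)) (T.card * (p + 1) - 1) := by
  induction hT using Finset.Nonempty.cons_induction with
  | singleton i =>
    have h : ∀ k, ∑ κ ∈ ({i} : Finset ι).piAntidiag k, ∏ j ∈ {i}, u (κ j) = u k := fun k => by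
      have h1 := Finset.sum_piAntidiag_cons_prod (Finset.notMem_empty i) (fun _ => u) k
      simp only [Finset.cons_empty] at h1
      rw [h1, Finset.sum_eq_single (k, 0)]
      · simp
      · intro x hx hx'
        have h2 : x.2 ≠ 0 := fun h0 => hx' (by
          have := Finset.HasAntidiagonal.mem_antidiagonal.1 hx
          ext <;> simp <;> omega)
        simp [h2]
      · simp
    simpa only [h, Finset.card_singleton, Nat.cast_one, one_mul, add_sub_cancel_right] using hu
  | cons i T hi hT ih =>
    simp only [Finset.sum_piAntidiag_cons_prod hi (fun _ => u)]
    have hT1 : (1 : ℝ) ≤ T.card := by exact_mod_cast hT.card_pos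
    convert hu.antidiagonal ih hp (by nlinarith) using 1
    rw [Finset.card_cons]
    push_cast
    ring

lemma card_nonLast (n : ℕ) : (nonLast n).card = n - 1 := by
  cases n with
  | zero => simp [nonLast]
  | succ m =>
    have : nonLast (m + 1) = Finset.univ.erase (Fin.last m) := by
      ext j
      simp [nonLast, Fin.ext_iff]
    simp [this]

lemma diagKernelNormSq_eq_sum_prod (n : ℕ) {β : ℝ} (hβ : -1 < β) (k : ℕ) :
    diagKernelNormSq n β k =
      ∑ κ ∈ (nonLast n).piAntidiag k, ∏ j ∈ nonLast n, (discMoment β (κ j))⁻¹ := by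
  refine Finset.sum_congr rfl fun κ hκ => ?_
  rw [prod_nonLast_eq (f := fun _ k => (discMoment β k)⁻¹) hκ (by simp [discMoment_zero hβ]),
    monomialNormSq, Finset.prod_inv_distrib]

lemma hasPowerOrder_diagKernelNormSq {n : ℕ} (hn : 2 ≤ n) {β : ℝ} (hβ : -1 < β) :
    HasPowerOrder (diagKernelNormSq n β) ((n - 1) * (β + 2) - 1) := by
  have hne : (nonLast n).Nonempty := by
    rw [← Finset.card_pos, card_nonLast]
    omega
  have h := (hasPowerOrder_discMoment hβ).inv.sum_piAntidiag_prod (by linarith) hne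
  convert h using 1
  · ext k
    exact diagKernelNormSq_eq_sum_prod n hβ k
  · rw [card_nonLast, Nat.cast_sub (by omega)]
    push_cast
    ring

/-- In one variable the composition operators in question are evaluations at a point. -/
lemma exists_diagKernelNormSq_one_mul_le (β : ℝ) (u : ℕ → ℝ) :
    ∃ C : ℝ, ∀ k, diagKernelNormSq 1 β k * u k ≤ C := by
  have h0 : nonLast 1 = ∅ := by
    rw [← Finset.card_eq_zero, card_nonLast]
  refine ⟨|diagKernelNormSq 1 β 0 * u 0|, fun k => ?_⟩
  rcases eq_or_ne k 0 with rfl | hk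
  · exact le_abs_self _
  · have : diagKernelNormSq 1 β k = 0 := by simp [diagKernelNormSq, h0, hk]
    rw [this, zero_mul]
    exact abs_nonneg _

/-- Under a power law for the norms of the powers of the symbol, boundedness is read off from
the exponents. For `n = 1` the operator is bounded for every exponent, because `diagKernelNormSq`
then vanishes at `k ≠ 0`; `hq1` asks that the inequality hold in this case too. -/
lemma isBoundedCompOp_diagonalMap_iff_le {n : ℕ} (hn : 1 ≤ n) {β : ℝ} (hβ : -1 < β)
    {φ : (Fin n → ℂ) → ℂ}
    (hφ : Differentiable ℂ φ) (hmap : Set.MapsTo φ (polydisc n) (Metric.ball 0 1)) {d : ℕ}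
    (hd : d ≠ 0) (hhom : ∀ c : ℂ, ‖c‖ = 1 → ∀ z, φ (fun j => c * z j) = c ^ d * φ z) {q : ℝ}
    (hq : HasPowerOrder (symbolMoment n β φ) q)
    (hq1 : n = 1 → ((n : ℝ) - 1) * (β + 2) - 1 + q ≤ 0) :
    IsBoundedCompOp n β (diagonalMap n φ) ↔ ((n : ℝ) - 1) * (β + 2) - 1 + q ≤ 0 := by
  rw [isBoundedCompOp_diagonalMap_iff hβ hφ hmap hd hhom]
  rcases hn.eq_or_lt with rfl | hn
  · exact iff_of_true (exists_diagKernelNormSq_one_mul_le β _) (hq1 rfl)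
  · exact ((hasPowerOrder_diagKernelNormSq hn hβ).mul hq).bounded_iff

/-! ### The symbol `z₁ ⋯ zₙ` -/

lemma symbolMoment_prodFun (n : ℕ) {β : ℝ} (hβ : -1 < β) (k : ℕ) :
    symbolMoment n β (prodFun n) k = discMoment β k ^ n := by
  have h := integral_norm_sq_sum_monomialFun (n := n) hβ (e := fun κ => κ)
    (fun _ _ h => h) {fun _ => k} fun _ => 1
  simp only [Finset.sum_singleton, one_mul, norm_one, one_pow, monomialNormSq, Finset.prod_const,
    Finset.card_univ, Fintype.card_fin] at h
  rw [← h, symbolMoment]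
  simp only [prodFun, monomialFun, Finset.prod_pow]

lemma prodFun_homogeneous (n : ℕ) (c : ℂ) (z : Fin n → ℂ) :
    prodFun n (fun j => c * z j) = c ^ n * prodFun n z := by
  simp [prodFun, Finset.prod_mul_distrib]

theorem isBoundedCompOp_prodFun_iff {n : ℕ} (hn : 1 ≤ n) {β : ℝ} (hβ : -1 < β) :
    IsBoundedCompOp n β (diagonalMap n (prodFun n)) ↔ (n : ℝ) ≤ β + 3 := by
  have hq : HasPowerOrder (symbolMoment n β (prodFun n)) (n * -(β + 1)) := by
    have := (hasPowerOrder_discMoment hβ).pow n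
    simpa only [← symbolMoment_prodFun n hβ] using this
  rw [isBoundedCompOp_diagonalMap_iff_le hn hβ (prodFun_differentiable n) (prodFun_mapsTo hn)
    (by omega) (fun c _ z => prodFun_homogeneous n c z) hq]
  · constructor <;> intro h <;> linarith
  · rintro rfl
    push_cast
    linarith

/-! ### Sums of squares of multinomial probabilities -/

/-- The multinomial probability of the counts `κ` for cell probabilities `p`. -/
def multinomialProb {ι : Type*} [Fintype ι] (p : ι → ℝ) (κ : ι → ℕ) : ℝ :=
  (Nat.multinomial Finset.univ κ : ℝ) * ∏ j, p j ^ κ j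

section Multinomial

variable {ι : Type*} [Fintype ι] {p : ι → ℝ}

lemma multinomialProb_nonneg (hp : ∀ j, 0 < p j) (κ : ι → ℕ) : 0 ≤ multinomialProb p κ :=
  mul_nonneg (Nat.cast_nonneg _) (Finset.prod_nonneg fun j _ => pow_nonneg (hp j).le _)

lemma multinomialProb_eq (p : ι → ℝ) (κ : ι → ℕ) :
    multinomialProb p κ = ((∑ j, κ j).factorial : ℝ) * ∏ j, (p j ^ κ j / (κ j).factorial) := by
  have h : (∏ j, ((κ j).factorial : ℝ)) * Nat.multinomial Finset.univ κ =
      (∑ j, κ j).factorial := by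
    exact_mod_cast Nat.multinomial_spec Finset.univ κ
  have h0 : (∏ j, ((κ j).factorial : ℝ)) ≠ 0 :=
    Finset.prod_ne_zero_iff.2 fun j _ => by positivity
  rw [multinomialProb, Finset.prod_div_distrib, ← h]
  field_simp

variable [DecidableEq ι]

/-- The generating function of the multinomial distribution. -/
lemma sum_multinomialProb_mul_prod (p y : ι → ℝ) (k : ℕ) :
    ∑ κ ∈ Finset.univ.piAntidiag k, multinomialProb p κ * ∏ j, y j ^ κ j =
      (∑ j, p j * y j) ^ k := by
  rw [Finset.sum_pow_eq_sum_piAntidiag]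
  refine Finset.sum_congr rfl fun κ _ => ?_
  simp only [multinomialProb, mul_pow, Finset.prod_mul_distrib, mul_assoc]

lemma sum_multinomialProb (hp1 : ∑ j, p j = 1) (k : ℕ) :
    ∑ κ ∈ (Finset.univ : Finset ι).piAntidiag k, multinomialProb p κ = 1 := by
  simpa [hp1] using sum_multinomialProb_mul_prod p (fun _ => 1) k

lemma factorial_add_le (a l : ℕ) :
    (a + l).factorial ≤ l.factorial * (a.factorial * (a + 1) ^ l) := by
  induction l with
  | zero => simp
  | succ l ih =>
    rw [← add_assoc, Nat.factorial_succ, Nat.factorial_succ, pow_succ]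
    have h : a + l + 1 ≤ (l + 1) * (a + 1) := by nlinarith
    calc _ ≤ (l + 1) * (a + 1) * (l.factorial * (a.factorial * (a + 1) ^ l)) := Nat.mul_le_mul h ih
      _ = _ := by ring

/-- Negative integer moments of the multinomial distribution, by shifting the counts. -/
lemma sum_multinomialProb_mul_inv_pow_le (hp : ∀ j, 0 < p j) (hp1 : ∑ j, p j = 1) (l k : ℕ) :
    ∑ κ ∈ (Finset.univ : Finset ι).piAntidiag k,
      multinomialProb p κ * ∏ j, (((κ j : ℝ) + 1) ^ l)⁻¹ ≤
      (∏ j, ((l.factorial : ℝ) / p j ^ l)) * (((k : ℝ) + 1) ^ (Fintype.card ι * l))⁻¹ := by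
  set N := Fintype.card ι * l with hN
  have hsum : ∀ κ : ι → ℕ, ∑ j, (κ j + l) = ∑ j, κ j + N := fun κ => by
    simp [Finset.sum_add_distrib, hN]
  have hterm : ∀ κ ∈ (Finset.univ : Finset ι).piAntidiag k,
      multinomialProb p κ * ∏ j, (((κ j : ℝ) + 1) ^ l)⁻¹ ≤
      (∏ j, ((l.factorial : ℝ) / p j ^ l)) * (((k : ℝ) + 1) ^ N)⁻¹ *
        multinomialProb p (fun j => κ j + l) := by
    intro κ hκ
    have hk := (Finset.mem_piAntidiag.1 hκ).1
    rw [multinomialProb_eq, multinomialProb_eq, hsum, hk]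
    have h1 : ((k.factorial : ℝ)) ≤ (((k : ℝ) + 1) ^ N)⁻¹ * ((k + N).factorial : ℝ) := by
      rw [inv_mul_eq_div, le_div_iff₀ (by positivity)]
      exact_mod_cast Nat.factorial_mul_pow_le_factorial
    have h2 : (∏ j, (p j ^ κ j / ((κ j).factorial : ℝ))) * ∏ j, (((κ j : ℝ) + 1) ^ l)⁻¹ ≤
        (∏ j, ((l.factorial : ℝ) / p j ^ l)) *
          ∏ j, (p j ^ (κ j + l) / ((κ j + l).factorial : ℝ)) := by
      rw [← Finset.prod_mul_distrib, ← Finset.prod_mul_distrib]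
      refine Finset.prod_le_prod (fun j _ => ?_) fun j _ => ?_
      · have := hp j
        positivity
      · have h3 : ((κ j + l).factorial : ℝ) ≤
            l.factorial * ((κ j).factorial * ((κ j : ℝ) + 1) ^ l) := by
          exact_mod_cast factorial_add_le (κ j) l
        have h4 := hp j
        have h5 : (l.factorial : ℝ) / p j ^ l * (p j ^ (κ j + l) / ((κ j + l).factorial : ℝ)) =
            p j ^ κ j * (l.factorial / ((κ j + l).factorial : ℝ)) := by
          rw [pow_add]
          field_simp
        rw [h5, div_mul_eq_mul_div, mul_div_assoc]
        refine mul_le_mul_of_nonneg_left ?_ (by positivity)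
        rw [div_le_div_iff₀ (by positivity) (by positivity), inv_mul_le_iff₀ (by positivity)]
        linarith
    have h6 : 0 ≤ (∏ j, (p j ^ κ j / ((κ j).factorial : ℝ))) * ∏ j, (((κ j : ℝ) + 1) ^ l)⁻¹ := by
      refine mul_nonneg (Finset.prod_nonneg fun j _ => ?_) (Finset.prod_nonneg fun j _ => ?_)
      · have := hp j
        positivity
      · positivity
    calc _ = (k.factorial : ℝ) * ((∏ j, (p j ^ κ j / ((κ j).factorial : ℝ))) *
          ∏ j, (((κ j : ℝ) + 1) ^ l)⁻¹) := by ring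
      _ ≤ (((k : ℝ) + 1) ^ N)⁻¹ * ((k + N).factorial : ℝ) *
          ((∏ j, ((l.factorial : ℝ) / p j ^ l)) *
          ∏ j, (p j ^ (κ j + l) / ((κ j + l).factorial : ℝ))) :=
          mul_le_mul h1 h2 h6 (by positivity)
      _ = _ := by ring
  refine (Finset.sum_le_sum hterm).trans ?_
  rw [← Finset.mul_sum]
  refine mul_le_of_le_one_right ?_ ?_
  · refine mul_nonneg (Finset.prod_nonneg fun j _ => ?_) (by positivity)
    have := hp j
    positivity
  · rw [← sum_multinomialProb hp1 (k + N)]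
    rw [← Finset.sum_image (f := multinomialProb p)
      (g := fun (κ : ι → ℕ) j => κ j + l) (s := (Finset.univ : Finset ι).piAntidiag k)]
    · refine Finset.sum_le_sum_of_subset_of_nonneg ?_ fun κ _ _ => multinomialProb_nonneg hp κ
      intro κ' hκ'
      obtain ⟨κ, hκ, rfl⟩ := Finset.mem_image.1 hκ'
      rw [Finset.mem_piAntidiag]
      exact ⟨by rw [hsum, (Finset.mem_piAntidiag.1 hκ).1], fun _ _ => Finset.mem_univ _⟩
    · intro a _ b _ hab
      ext j
      have := congrFun hab j
      simpa using this

/-- Negative real moments of the multinomial distribution, by Jensen's inequality. -/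
lemma exists_sum_multinomialProb_mul_rpow_le (hp : ∀ j, 0 < p j) (hp1 : ∑ j, p j = 1) {q : ℝ}
    (hq : 0 < q) : ∃ C : ℝ, 0 < C ∧ ∀ k : ℕ, ∑ κ ∈ (Finset.univ : Finset ι).piAntidiag k,
      multinomialProb p κ * ∏ j, ((κ j : ℝ) + 1) ^ (-q) ≤
      C * ((k : ℝ) + 1) ^ (-(Fintype.card ι * q)) := by
  obtain ⟨l, hl⟩ := exists_nat_ge q
  have hl0 : (0 : ℝ) < l := hq.trans_le hl
  set D := ∏ j, ((l.factorial : ℝ) / p j ^ l) with hD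
  have hD0 : 0 < D := Finset.prod_pos fun j _ => by
    have := hp j
    positivity
  refine ⟨D ^ (q / l), by positivity, fun k => ?_⟩
  have hz : ∀ κ : ι → ℕ, 0 ≤ ∏ j, ((κ j : ℝ) + 1) ^ (-q) := fun κ =>
    Finset.prod_nonneg fun j _ => by positivity
  have h1 := Real.arith_mean_le_rpow_mean ((Finset.univ : Finset ι).piAntidiag k)
    (multinomialProb p) (fun κ => ∏ j, ((κ j : ℝ) + 1) ^ (-q))
    (fun κ _ => multinomialProb_nonneg hp κ) (sum_multinomialProb hp1 k) (fun κ _ => hz κ)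
    (p := l / q) ((one_le_div hq).2 hl)
  have h2 : ∀ κ : ι → ℕ, (∏ j, ((κ j : ℝ) + 1) ^ (-q)) ^ ((l : ℝ) / q) =
      ∏ j, (((κ j : ℝ) + 1) ^ l)⁻¹ := fun κ => by
    rw [← Real.finsetProd_rpow _ _ fun j _ => by positivity]
    refine Finset.prod_congr rfl fun j _ => ?_
    rw [← Real.rpow_mul (by positivity), ← Real.rpow_natCast, ← Real.rpow_neg (by positivity)]
    congr 1
    field_simp
  simp only [h2, one_div_div] at h1
  refine h1.trans ?_
  calc _ ≤ (D * (((k : ℝ) + 1) ^ (Fintype.card ι * l))⁻¹) ^ (q / l) := by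
        refine Real.rpow_le_rpow ?_ (sum_multinomialProb_mul_inv_pow_le hp hp1 l k) (by positivity)
        refine Finset.sum_nonneg fun κ _ => mul_nonneg (multinomialProb_nonneg hp κ) ?_
        exact Finset.prod_nonneg fun j _ => by positivity
    _ = _ := by
        rw [Real.mul_rpow hD0.le (by positivity), ← Real.rpow_natCast,
          ← Real.rpow_neg (by positivity), ← Real.rpow_mul (by positivity)]
        congr 2
        push_cast
        field_simp

end Multinomial

/-- Stirling's formula. -/
lemma hasPowerOrder_factorial_div :
    HasPowerOrder (fun k => (k.factorial : ℝ) / (k / Real.exp 1) ^ k) (1 / 2) := by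
  have hpos : ∀ k : ℕ, 0 < ((k : ℝ) / Real.exp 1) ^ k := fun k => by
    rcases eq_or_ne k 0 with rfl | hk
    · simp
    · have : (0 : ℝ) < k := by exact_mod_cast Nat.pos_of_ne_zero hk
      positivity
  refine HasPowerOrder.of_tendsto (fun k => div_pos (by positivity) (hpos k))
    (L := √2 * √Real.pi) (by have := Real.pi_pos; positivity) ?_
  have h2 : Tendsto (fun k : ℕ => √((k : ℝ) / (k + 1))) atTop (𝓝 √1) :=
    (Real.continuous_sqrt.tendsto _).comp (tendsto_natCast_div_add_atTop (1 : ℝ))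
  have h3 := (h2.mul_const (√2)).mul Stirling.tendsto_stirlingSeq_sqrt_pi
  rw [Real.sqrt_one, one_mul] at h3
  refine h3.congr' ?_
  filter_upwards [eventually_gt_atTop 0] with k hk
  have hk' : (0 : ℝ) < k := by exact_mod_cast hk
  have := hpos k
  rw [Stirling.stirlingSeq, Real.sqrt_div hk'.le, Real.sqrt_mul zero_le_two, ← Real.sqrt_eq_rpow]
  have h4 : 0 < √(k : ℝ) := Real.sqrt_pos.2 hk'
  field_simp

/-- A multinomial probability is at most the quotient of the correction factors in Stirling's
formula; the exponential factors compare by `1 + x ≤ exp x`. -/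
lemma multinomialProb_le {ι : Type*} [Fintype ι] {p : ι → ℝ} (hp : ∀ j, 0 < p j)
    (hp1 : ∑ j, p j = 1) (κ : ι → ℕ) :
    multinomialProb p κ ≤ (((∑ j, κ j).factorial : ℝ) /
      (((∑ j, κ j : ℕ) : ℝ) / Real.exp 1) ^ (∑ j, κ j)) *
        ∏ j, (((κ j).factorial : ℝ) / ((κ j : ℝ) / Real.exp 1) ^ κ j)⁻¹ := by
  set k := ∑ j, κ j with hk
  have hpos : ∀ k : ℕ, 0 < ((k : ℝ) / Real.exp 1) ^ k := fun k => by
    rcases eq_or_ne k 0 with rfl | hk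
    · simp
    · have : (0 : ℝ) < k := by exact_mod_cast Nat.pos_of_ne_zero hk
      positivity
  have h1 : ∀ j, ((k : ℝ) / Real.exp 1 * p j) ^ κ j ≤
      ((κ j : ℝ) / Real.exp 1) ^ κ j * Real.exp (k * p j - κ j) := fun j => by
    rcases eq_or_ne (κ j) 0 with h0 | h0
    · rw [h0]
      simp only [pow_zero, one_mul, Nat.cast_zero, sub_zero, Real.one_le_exp_iff]
      have := hp j
      positivity
    · have hκ : (0 : ℝ) < κ j := by exact_mod_cast Nat.pos_of_ne_zero h0
      have h2 : (k : ℝ) * p j / κ j ≤ Real.exp (k * p j / κ j - 1) := by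
        have := Real.add_one_le_exp ((k : ℝ) * p j / κ j - 1)
        linarith
      have h3 : Real.exp (k * p j - κ j) = Real.exp (k * p j / κ j - 1) ^ κ j := by
        rw [← Real.exp_nat_mul]
        congr 1
        field_simp
      have := hp j
      rw [h3, ← mul_pow]
      refine pow_le_pow_left₀ (by positivity) ?_ _
      calc (k : ℝ) / Real.exp 1 * p j = κ j / Real.exp 1 * (k * p j / κ j) := by field_simp
        _ ≤ _ := by gcongr
  have h2 : ((k : ℝ) / Real.exp 1) ^ k * ∏ j, p j ^ κ j ≤ ∏ j, ((κ j : ℝ) / Real.exp 1) ^ κ j := by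
    calc _ = ∏ j, ((k : ℝ) / Real.exp 1 * p j) ^ κ j := by
          simp only [mul_pow, Finset.prod_mul_distrib, Finset.prod_pow_eq_pow_sum, ← hk]
      _ ≤ ∏ j, (((κ j : ℝ) / Real.exp 1) ^ κ j * Real.exp (k * p j - κ j)) :=
          Finset.prod_le_prod (fun j _ => by have := hp j; positivity) fun j _ => h1 j
      _ = _ := by
          rw [Finset.prod_mul_distrib, ← Real.exp_sum, Finset.sum_sub_distrib, ← Finset.mul_sum,
            hp1, mul_one, ← Nat.cast_sum, ← hk, sub_self, Real.exp_zero, mul_one]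
  rw [multinomialProb_eq, ← hk]
  simp only [inv_div, Finset.prod_div_distrib]
  rw [div_mul_div_comm, mul_div_assoc', div_le_div_iff₀ (Finset.prod_pos fun j _ => by positivity)
    (mul_pos (hpos k) (Finset.prod_pos fun j _ => by positivity))]
  have h3 : (0 : ℝ) ≤ k.factorial * ∏ j, ((κ j).factorial : ℝ) := by positivity
  calc _ = (k.factorial * ∏ j, ((κ j).factorial : ℝ)) *
        (((k : ℝ) / Real.exp 1) ^ k * ∏ j, p j ^ κ j) := by ring
    _ ≤ _ := mul_le_mul_of_nonneg_left h2 h3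
    _ = _ := by ring

lemma HasPowerOrder.exists_prod_le {ι : Type*} [Fintype ι] {u : ℕ → ℝ} {q : ℝ}
    (hu : HasPowerOrder u q) : ∃ C : ℝ, 0 < C ∧ ∀ κ : ι → ℕ,
      ∏ j, u (κ j) ≤ C * ∏ j, ((κ j : ℝ) + 1) ^ q := by
  have hpos := hu.pos
  obtain ⟨_, C, _, hC, h⟩ := hu
  refine ⟨C ^ Fintype.card ι, by positivity, fun κ => ?_⟩
  calc _ ≤ ∏ j, C * ((κ j : ℝ) + 1) ^ q :=
        Finset.prod_le_prod (fun j _ => (hpos _).le) fun j _ => (h _).2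
    _ = _ := by rw [Finset.prod_mul_distrib, Finset.prod_const, Finset.card_univ]

lemma exists_sum_multinomialProb_sq_le {ι : Type*} [Fintype ι] [DecidableEq ι] {p : ι → ℝ}
    (hp : ∀ j, 0 < p j) (hp1 : ∑ j, p j = 1) {v : ℕ → ℝ} {s : ℝ} (hs : 0 ≤ s)
    (hv : HasPowerOrder v (-s)) : ∃ C : ℝ, 0 < C ∧ ∀ k : ℕ,
      ∑ κ ∈ (Finset.univ : Finset ι).piAntidiag k, multinomialProb p κ ^ 2 * ∏ j, v (κ j) ≤
      C * ((k : ℝ) + 1) ^ (-(((Fintype.card ι : ℝ) - 1) / 2) - Fintype.card ι * s) := by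
  have hh := hasPowerOrder_factorial_div
  set h : ℕ → ℝ := fun k => (k.factorial : ℝ) / (k / Real.exp 1) ^ k with hdef
  have hw := hh.inv.mul hv
  rw [← neg_add] at hw
  obtain ⟨C₁, hC₁, h₁⟩ := hw.exists_prod_le (ι := ι)
  obtain ⟨C₂, hC₂, h₂⟩ := exists_sum_multinomialProb_mul_rpow_le hp hp1
    (q := 1 / 2 + s) (by linarith)
  have hhp := hh.pos
  have hvp := hv.pos
  obtain ⟨_, C₃, _, hC₃, h₃⟩ := hh
  refine ⟨C₃ * C₁ * C₂, by positivity, fun k => ?_⟩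
  calc _ ≤ ∑ κ ∈ (Finset.univ : Finset ι).piAntidiag k,
        h k * C₁ * (multinomialProb p κ * ∏ j, ((κ j : ℝ) + 1) ^ (-(1 / 2 + s))) := by
        refine Finset.sum_le_sum fun κ hκ => ?_
        have hM := multinomialProb_le hp hp1 κ
        rw [(Finset.mem_piAntidiag.1 hκ).1] at hM
        have hM0 := multinomialProb_nonneg hp κ
        have hV : 0 ≤ ∏ j, v (κ j) := Finset.prod_nonneg fun j _ => (hvp _).le
        calc multinomialProb p κ ^ 2 * ∏ j, v (κ j)
            = multinomialProb p κ * (multinomialProb p κ * ∏ j, v (κ j)) := by ring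
          _ ≤ multinomialProb p κ * ((h k * ∏ j, (h (κ j))⁻¹) * ∏ j, v (κ j)) := by gcongr
          _ = h k * multinomialProb p κ * ∏ j, ((h (κ j))⁻¹ * v (κ j)) := by
              rw [Finset.prod_mul_distrib]
              ring
          _ ≤ h k * multinomialProb p κ * (C₁ * ∏ j, ((κ j : ℝ) + 1) ^ (-(1 / 2 + s))) := by
              have := (hhp k).le
              exact mul_le_mul_of_nonneg_left (h₁ κ) (by positivity)
          _ = _ := by ring
    _ = h k * C₁ * ∑ κ ∈ (Finset.univ : Finset ι).piAntidiag k,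
        multinomialProb p κ * ∏ j, ((κ j : ℝ) + 1) ^ (-(1 / 2 + s)) := by rw [Finset.mul_sum]
    _ ≤ (C₃ * ((k : ℝ) + 1) ^ (1 / 2 : ℝ)) * C₁ *
        (C₂ * ((k : ℝ) + 1) ^ (-(Fintype.card ι * (1 / 2 + s)))) := by
        have := (hhp k).le
        refine mul_le_mul (mul_le_mul_of_nonneg_right (h₃ k).2 hC₁.le) (h₂ k)
          (Finset.sum_nonneg fun κ _ => mul_nonneg (multinomialProb_nonneg hp κ) ?_) (by positivity)
        exact Finset.prod_nonneg fun j _ => by positivity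
    _ = _ := by
        rw [show -(((Fintype.card ι : ℝ) - 1) / 2) - Fintype.card ι * s =
          1 / 2 + -(Fintype.card ι * (1 / 2 + s)) by ring, Real.rpow_add (by positivity)]
        ring

/-! ### Concentration of the multinomial distribution -/

section Concentration

variable {ι : Type*} [Fintype ι] [DecidableEq ι] {p : ι → ℝ}

/-- A single count has exponential moments at the scale `√(k + 1)`. -/
lemma sum_multinomialProb_mul_exp_le (hp : ∀ j, 0 < p j) (hp1 : ∑ j, p j = 1) (j : ι) (k : ℕ)
    {t : ℝ} (ht : |t| ≤ 1) (htk : k * t ^ 2 ≤ 1) :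
    ∑ κ ∈ (Finset.univ : Finset ι).piAntidiag k,
      multinomialProb p κ * Real.exp (t * (κ j - k * p j)) ≤ Real.exp 1 := by
  have h1 := sum_multinomialProb_mul_prod p (fun i => if i = j then Real.exp t else 1) k
  have h2 : ∑ i, p i * (if i = j then Real.exp t else 1) = 1 + p j * (Real.exp t - 1) := by
    have : ∀ i, p i * (if i = j then Real.exp t else 1) =
        p i + if i = j then p i * (Real.exp t - 1) else 0 := fun i => by
      split_ifs <;> ring
    simp only [this, Finset.sum_add_distrib, hp1, Finset.sum_ite_eq', Finset.mem_univ, if_true]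
  have h3 : ∀ κ : ι → ℕ, ∏ i, (if i = j then Real.exp t else 1) ^ κ i = Real.exp (κ j * t) :=
    fun κ => by
      simp only [ite_pow, one_pow, Finset.prod_ite_eq', Finset.mem_univ, if_true, Real.exp_nat_mul]
  simp only [h2, h3] at h1
  have hpj : p j ≤ 1 := hp1 ▸ Finset.single_le_sum (fun i _ => (hp i).le) (Finset.mem_univ j)
  have h4 : 0 ≤ 1 + p j * (Real.exp t - 1) := by
    have := Real.exp_pos t
    nlinarith [hp j]
  calc _ = (∑ κ ∈ (Finset.univ : Finset ι).piAntidiag k,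
        multinomialProb p κ * Real.exp (κ j * t)) * Real.exp (-(t * (k * p j))) := by
        rw [Finset.sum_mul]
        refine Finset.sum_congr rfl fun κ _ => ?_
        rw [mul_assoc, ← Real.exp_add]
        ring_nf
    _ = (1 + p j * (Real.exp t - 1)) ^ k * Real.exp (-(t * (k * p j))) := by rw [h1]
    _ ≤ Real.exp (p j * (Real.exp t - 1)) ^ k * Real.exp (-(t * (k * p j))) := by
        gcongr
        linarith [Real.add_one_le_exp (p j * (Real.exp t - 1))]
    _ = Real.exp (k * p j * (Real.exp t - 1 - t)) := by
        rw [← Real.exp_nat_mul, ← Real.exp_add]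
        ring_nf
    _ ≤ Real.exp 1 := by
        rw [Real.exp_le_exp]
        have h5 := (abs_le.1 (Real.abs_exp_sub_one_sub_id_le ht)).2
        calc k * p j * (Real.exp t - 1 - t) ≤ k * p j * t ^ 2 := by
              have := hp j
              gcongr
          _ = p j * (k * t ^ 2) := by ring
          _ ≤ 1 := mul_le_one₀ hpj (by positivity) htk

/-- The counts `κ` that stay within `r` of their means. -/
def typicalCounts (p : ι → ℝ) (k : ℕ) (r : ℝ) : Finset (ι → ℕ) :=
  {κ ∈ (Finset.univ : Finset ι).piAntidiag k | ∀ j, |(κ j : ℝ) - k * p j| ≤ r}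

lemma half_le_sum_typicalCounts (hp : ∀ j, 0 < p j) (hp1 : ∑ j, p j = 1) (k : ℕ) :
    1 / 2 ≤ ∑ κ ∈ typicalCounts p k ((4 * Fintype.card ι + 1) * √((k : ℝ) + 1)),
      multinomialProb p κ := by
  set N : ℝ := (Fintype.card ι : ℝ) with hN
  set R : ℝ := 4 * N + 1 with hR
  have hN0 : 0 ≤ N := Nat.cast_nonneg _
  have hk0 : (0 : ℝ) ≤ k := Nat.cast_nonneg _
  have hsq : 0 < √((k : ℝ) + 1) := Real.sqrt_pos.2 (by positivity)
  have hsq1 : 1 ≤ √((k : ℝ) + 1) := Real.one_le_sqrt.2 (by linarith)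
  set t : ℝ := 1 / √((k : ℝ) + 1) with ht
  have ht0 : 0 < t := by positivity
  have ht1 : t ≤ 1 := (div_le_one hsq).2 hsq1
  have htk : k * t ^ 2 ≤ 1 := by
    rw [ht, div_pow, Real.sq_sqrt (by positivity), one_pow, mul_one_div, div_le_one (by positivity)]
    linarith
  -- Each atypical count vector is penalized by an exponential weight of size at least `exp R`.
  have hpt : ∀ κ ∈ (Finset.univ : Finset ι).piAntidiag k,
      κ ∉ typicalCounts p k (R * √((k : ℝ) + 1)) →
      Real.exp R ≤ ∑ j, (Real.exp (t * (κ j - k * p j)) + Real.exp (-t * (κ j - k * p j))) := by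
    intro κ hκ hκ'
    have : ∃ j, R * √((k : ℝ) + 1) < |(κ j : ℝ) - k * p j| := by
      by_contra! h
      exact hκ' (Finset.mem_filter.2 ⟨hκ, h⟩)
    obtain ⟨j, hj⟩ := this
    refine le_trans ?_ (Finset.single_le_sum (f := fun j => Real.exp (t * (κ j - k * p j)) +
      Real.exp (-t * (κ j - k * p j))) (fun i _ => by positivity) (Finset.mem_univ j))
    have h1 : R ≤ t * |(κ j : ℝ) - k * p j| := by
      rw [ht, one_div_mul_eq_div, le_div_iff₀ hsq]
      exact hj.le
    have h2 : Real.exp R ≤ Real.exp (t * |(κ j : ℝ) - k * p j|) := Real.exp_le_exp.2 h1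
    have h3 := Real.exp_pos (t * (κ j - k * p j))
    have h4 := Real.exp_pos (-t * (κ j - k * p j))
    rcases abs_cases ((κ j : ℝ) - k * p j) with ⟨h, -⟩ | ⟨h, -⟩
    · rw [h] at h2
      linarith
    · rw [h, mul_neg, ← neg_mul] at h2
      linarith
  have hbad : ∑ κ ∈ (Finset.univ : Finset ι).piAntidiag k \ typicalCounts p k
      (R * √((k : ℝ) + 1)), multinomialProb p κ ≤ 1 / 2 := by
    have h1 : Real.exp R * ∑ κ ∈ (Finset.univ : Finset ι).piAntidiag k \ typicalCounts p k
        (R * √((k : ℝ) + 1)), multinomialProb p κ ≤ N * (2 * Real.exp 1) := by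
      calc _ ≤ ∑ κ ∈ (Finset.univ : Finset ι).piAntidiag k \ typicalCounts p k
            (R * √((k : ℝ) + 1)), multinomialProb p κ * ∑ j, (Real.exp (t * (κ j - k * p j)) +
              Real.exp (-t * (κ j - k * p j))) := by
            rw [Finset.mul_sum]
            refine Finset.sum_le_sum fun κ hκ => ?_
            rw [Finset.mem_sdiff] at hκ
            rw [mul_comm]
            exact mul_le_mul_of_nonneg_left (hpt κ hκ.1 hκ.2) (multinomialProb_nonneg hp κ)
        _ ≤ ∑ κ ∈ (Finset.univ : Finset ι).piAntidiag k, multinomialProb p κ *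
            ∑ j, (Real.exp (t * (κ j - k * p j)) + Real.exp (-t * (κ j - k * p j))) := by
            refine Finset.sum_le_sum_of_subset_of_nonneg Finset.sdiff_subset fun κ _ _ => ?_
            exact mul_nonneg (multinomialProb_nonneg hp κ)
              (Finset.sum_nonneg fun j _ => by positivity)
        _ = ∑ j, (∑ κ ∈ (Finset.univ : Finset ι).piAntidiag k, multinomialProb p κ *
            Real.exp (t * (κ j - k * p j)) + ∑ κ ∈ (Finset.univ : Finset ι).piAntidiag k,
            multinomialProb p κ * Real.exp (-t * (κ j - k * p j))) := by
            simp only [Finset.mul_sum, mul_add, ← Finset.sum_add_distrib]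
            rw [Finset.sum_comm]
        _ ≤ ∑ _j : ι, (Real.exp 1 + Real.exp 1) := by
            refine Finset.sum_le_sum fun j _ => add_le_add ?_ ?_
            · exact sum_multinomialProb_mul_exp_le hp hp1 j k (by rwa [abs_of_pos ht0]) htk
            · exact sum_multinomialProb_mul_exp_le hp hp1 j k (by rwa [abs_neg, abs_of_pos ht0])
                (by rwa [neg_sq])
        _ = _ := by
            rw [Finset.sum_const, Finset.card_univ, nsmul_eq_mul]
            ring
    have h2 : Real.exp R = Real.exp (4 * N) * Real.exp 1 := by rw [hR, Real.exp_add]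
    have h3 : 4 * N + 1 ≤ Real.exp (4 * N) := Real.add_one_le_exp _
    have h4 := Real.exp_pos 1
    rw [h2] at h1
    set B := ∑ κ ∈ (Finset.univ : Finset ι).piAntidiag k \ typicalCounts p k
      (R * √((k : ℝ) + 1)), multinomialProb p κ
    have hB : 0 ≤ B := Finset.sum_nonneg fun κ _ => multinomialProb_nonneg hp κ
    have h5 : Real.exp (4 * N) * B ≤ 2 * N := by
      refine le_of_mul_le_mul_right ?_ h4
      linarith
    have h6 : (4 * N + 1) * B ≤ 2 * N := (mul_le_mul_of_nonneg_right h3 hB).trans h5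
    by_contra! hlt
    nlinarith
  have htot := sum_multinomialProb hp1 k
  have hsub : typicalCounts p k (R * √((k : ℝ) + 1)) ⊆ (Finset.univ : Finset ι).piAntidiag k :=
    Finset.filter_subset _ _
  rw [← Finset.sum_sdiff hsub] at htot
  linarith

lemma card_Icc_ceil_floor_le (x : ℝ) (hx : 0 ≤ x) {r : ℝ} (hr : 0 ≤ r) :
    ((Finset.Icc ⌈x - r⌉₊ ⌊x + r⌋₊).card : ℝ) ≤ 2 * r + 1 := by
  rw [Nat.card_Icc]
  rcases le_total ⌈x - r⌉₊ (⌊x + r⌋₊ + 1) with h | h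
  · rw [Nat.cast_sub h]
    push_cast
    linarith [Nat.floor_le (show 0 ≤ x + r by linarith), Nat.le_ceil (x - r)]
  · rw [Nat.sub_eq_zero_of_le h]
    push_cast
    linarith

/-- A count vector is determined by all of its entries but one, so the typical ones number at
most the `(N - 1)`-st power of the width. -/
lemma card_typicalCounts_le [Nonempty ι] (hp : ∀ j, 0 < p j) (k : ℕ) {r : ℝ} (hr : 0 ≤ r) :
    ((typicalCounts p k r).card : ℝ) ≤ (2 * r + 1) ^ (Fintype.card ι - 1) := by
  obtain ⟨j₀⟩ := ‹Nonempty ι›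
  set box : Finset (ι → ℕ) := Fintype.piFinset fun j =>
    if j = j₀ then {0} else Finset.Icc ⌈(k : ℝ) * p j - r⌉₊ ⌊(k : ℝ) * p j + r⌋₊ with hbox
  have h1 : (typicalCounts p k r).card ≤ box.card := by
    refine Finset.card_le_card_of_injOn (fun κ => Function.update κ j₀ 0) ?_ ?_
    · intro κ hκ
      have hκ' := (Finset.mem_filter.1 hκ).2
      rw [Finset.mem_coe, hbox, Fintype.mem_piFinset]
      intro j
      by_cases hj : j = j₀
      · subst hj
        simp
      · dsimp only
        rw [if_neg hj, Function.update_of_ne hj, Finset.mem_Icc]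
        have h2 := abs_le.1 (hκ' j)
        exact ⟨Nat.ceil_le.2 (by linarith [h2.1]), Nat.le_floor (by linarith [h2.2])⟩
    · intro κ hκ κ' hκ' h
      have hs := (Finset.mem_piAntidiag.1 (Finset.mem_filter.1 hκ).1).1
      have hs' := (Finset.mem_piAntidiag.1 (Finset.mem_filter.1 hκ').1).1
      have hne : ∀ j, j ≠ j₀ → κ j = κ' j := fun j hj => by
        have := congrFun h j
        simpa [Function.update_of_ne hj] using this
      rw [← Finset.add_sum_erase _ _ (Finset.mem_univ j₀)] at hs hs'
      have h3 : ∑ j ∈ Finset.univ.erase j₀, κ j = ∑ j ∈ Finset.univ.erase j₀, κ' j :=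
        Finset.sum_congr rfl fun j hj => hne j (Finset.ne_of_mem_erase hj)
      ext j
      by_cases hj : j = j₀
      · subst hj
        omega
      · exact hne j hj
  calc ((typicalCounts p k r).card : ℝ) ≤ box.card := by exact_mod_cast h1
    _ = ∏ j, (((if j = j₀ then ({0} : Finset ℕ) else
        Finset.Icc ⌈(k : ℝ) * p j - r⌉₊ ⌊(k : ℝ) * p j + r⌋₊).card : ℕ) : ℝ) := by
        rw [hbox, Fintype.card_piFinset]
        push_cast
        rfl
    _ ≤ ∏ j, (if j = j₀ then 1 else 2 * r + 1) := by
        refine Finset.prod_le_prod (fun _ _ => Nat.cast_nonneg _) fun j _ => ?_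
        split_ifs
        · simp
        · have := hp j
          exact card_Icc_ceil_floor_le _ (by positivity) hr
    _ = _ := by
        rw [← Finset.mul_prod_erase _ _ (Finset.mem_univ j₀), if_pos rfl, one_mul,
          Finset.prod_congr rfl fun j hj => if_neg (Finset.ne_of_mem_erase hj), Finset.prod_const,
          Finset.card_erase_of_mem (Finset.mem_univ _), Finset.card_univ]

lemma exists_le_sum_multinomialProb_sq [Nonempty ι] (hp : ∀ j, 0 < p j) (hp1 : ∑ j, p j = 1) :
    ∃ c : ℝ, 0 < c ∧ ∀ k : ℕ, c * ((k : ℝ) + 1) ^ (-(((Fintype.card ι : ℝ) - 1) / 2)) ≤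
      ∑ κ ∈ (Finset.univ : Finset ι).piAntidiag k, multinomialProb p κ ^ 2 := by
  set D : ℝ := 2 * (4 * Fintype.card ι + 1) + 1 with hD
  have hD0 : 0 < D := by positivity
  refine ⟨1 / 4 * (D ^ (Fintype.card ι - 1))⁻¹, by positivity, fun k => ?_⟩
  have hk0 : (0 : ℝ) ≤ k := Nat.cast_nonneg _
  have hsq1 : 1 ≤ √((k : ℝ) + 1) := Real.one_le_sqrt.2 (by linarith)
  set S := typicalCounts p k ((4 * Fintype.card ι + 1) * √((k : ℝ) + 1)) with hS
  have h1 := half_le_sum_typicalCounts hp hp1 k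
  have h2 : (S.card : ℝ) ≤ (D * √((k : ℝ) + 1)) ^ (Fintype.card ι - 1) := by
    refine (card_typicalCounts_le hp k (by positivity)).trans ?_
    refine pow_le_pow_left₀ (by positivity) ?_ _
    rw [hD]
    linarith
  have h3 := sq_sum_le_card_mul_sum_sq (s := S) (f := multinomialProb p)
  have hX : 0 < (D * √((k : ℝ) + 1)) ^ (Fintype.card ι - 1) := by positivity
  have h4 : 1 / 4 ≤ (D * √((k : ℝ) + 1)) ^ (Fintype.card ι - 1) *
      ∑ κ ∈ (Finset.univ : Finset ι).piAntidiag k, multinomialProb p κ ^ 2 := by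
    calc (1 : ℝ) / 4 = (1 / 2) ^ 2 := by norm_num
      _ ≤ (∑ κ ∈ S, multinomialProb p κ) ^ 2 := by gcongr
      _ ≤ S.card * ∑ κ ∈ S, multinomialProb p κ ^ 2 := h3
      _ ≤ _ := by
          refine mul_le_mul h2 ?_ (Finset.sum_nonneg fun _ _ => sq_nonneg _) hX.le
          exact Finset.sum_le_sum_of_subset_of_nonneg (Finset.filter_subset _ _)
            fun _ _ _ => sq_nonneg _
  have h5 : ((k : ℝ) + 1) ^ (-(((Fintype.card ι : ℝ) - 1) / 2)) =
      (√((k : ℝ) + 1) ^ (Fintype.card ι - 1))⁻¹ := by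
    rw [Real.rpow_neg (by positivity), Real.sqrt_eq_rpow, ← Real.rpow_natCast,
      ← Real.rpow_mul (by positivity), Nat.cast_sub Fintype.card_pos]
    congr 2
    push_cast
    ring
  rw [h5, mul_assoc, ← mul_inv, ← mul_pow, ← div_eq_mul_inv, div_le_iff₀' hX]
  exact h4

/-- For the lower bound, `κ j ≤ k` bounds every `v (κ j)` below by a multiple of `(k + 1) ^ (-s)`,
and the squares of the multinomial probabilities alone sum to at least a multiple of
`(k + 1) ^ (-(N - 1) / 2)`. -/
lemma hasPowerOrder_sum_multinomialProb_sq [Nonempty ι] (hp : ∀ j, 0 < p j)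
    (hp1 : ∑ j, p j = 1) {v : ℕ → ℝ} {s : ℝ} (hs : 0 ≤ s) (hv : HasPowerOrder v (-s)) :
    HasPowerOrder (fun k => ∑ κ ∈ (Finset.univ : Finset ι).piAntidiag k,
      multinomialProb p κ ^ 2 * ∏ j, v (κ j))
      (-(((Fintype.card ι : ℝ) - 1) / 2) - Fintype.card ι * s) := by
  obtain ⟨C, hC, hupper⟩ := exists_sum_multinomialProb_sq_le hp hp1 hs hv
  obtain ⟨c, hc, hlower⟩ := exists_le_sum_multinomialProb_sq hp hp1
  obtain ⟨c', _, hc', _, h⟩ := hv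
  refine ⟨c * c' ^ Fintype.card ι, C, by positivity, hC, fun k => ⟨?_, hupper k⟩⟩
  have h1 : ∀ κ ∈ (Finset.univ : Finset ι).piAntidiag k,
      (c' * ((k : ℝ) + 1) ^ (-s)) ^ Fintype.card ι ≤ ∏ j, v (κ j) := by
    intro κ hκ
    rw [← Finset.card_univ, ← Finset.prod_const]
    refine Finset.prod_le_prod (fun _ _ => by positivity) fun j _ => le_trans ?_ (h (κ j)).1
    have h2 : (κ j : ℝ) ≤ k := by
      rw [← (Finset.mem_piAntidiag.1 hκ).1]
      exact_mod_cast Finset.single_le_sum (fun _ _ => Nat.zero_le _) (Finset.mem_univ j)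
    refine mul_le_mul_of_nonneg_left ?_ hc'.le
    exact Real.rpow_le_rpow_of_nonpos (by positivity) (by linarith) (by linarith)
  calc _ = c * ((k : ℝ) + 1) ^ (-(((Fintype.card ι : ℝ) - 1) / 2)) *
        (c' * ((k : ℝ) + 1) ^ (-s)) ^ Fintype.card ι := by
        rw [sub_eq_add_neg, Real.rpow_add (by positivity), mul_pow, ← Real.rpow_natCast
          (((k : ℝ) + 1) ^ (-s)), ← Real.rpow_mul (by positivity)]
        ring_nf
    _ ≤ (∑ κ ∈ (Finset.univ : Finset ι).piAntidiag k, multinomialProb p κ ^ 2) *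
        (c' * ((k : ℝ) + 1) ^ (-s)) ^ Fintype.card ι := by
        gcongr
        exact hlower k
    _ ≤ _ := by
        rw [Finset.sum_mul]
        exact Finset.sum_le_sum fun κ hκ => mul_le_mul_of_nonneg_left (h1 κ hκ) (sq_nonneg _)

end Concentration

/-! ### The symbol `α₁ z₁ⁿ + ⋯ + αₙ zₙⁿ` -/

lemma powerSumFun_homogeneous (n : ℕ) (α : Fin n → ℂ) (c : ℂ) (z : Fin n → ℂ) :
    powerSumFun n α (fun j => c * z j) = c ^ n * powerSumFun n α z := by
  simp only [powerSumFun, Finset.mul_sum]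
  exact Finset.sum_congr rfl fun j _ => by ring

lemma symbolMoment_powerSumFun {n : ℕ} (hn : 1 ≤ n) {β : ℝ} (hβ : -1 < β) (α : Fin n → ℂ)
    (k : ℕ) : symbolMoment n β (powerSumFun n α) k =
      ∑ κ ∈ (Finset.univ : Finset (Fin n)).piAntidiag k,
        multinomialProb (fun j => ‖α j‖) κ ^ 2 * ∏ j, discMoment β (n * κ j) := by
  have he : Function.Injective fun (κ : Fin n → ℕ) j => n * κ j := fun κ κ' h => by
    ext j
    exact Nat.eq_of_mul_eq_mul_left hn (congrFun h j)
  have h := integral_norm_sq_sum_monomialFun hβ he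
    ((Finset.univ : Finset (Fin n)).piAntidiag k)
    fun κ => (Nat.multinomial Finset.univ κ : ℂ) * ∏ j, α j ^ κ j
  have h1 : ∀ z : Fin n → ℂ, powerSumFun n α z ^ k =
      ∑ κ ∈ (Finset.univ : Finset (Fin n)).piAntidiag k,
        ((Nat.multinomial Finset.univ κ : ℂ) * ∏ j, α j ^ κ j) *
          monomialFun (fun j => n * κ j) z := fun z => by
    rw [powerSumFun, Finset.sum_pow_eq_sum_piAntidiag]
    refine Finset.sum_congr rfl fun κ _ => ?_
    simp only [monomialFun, mul_pow, Finset.prod_mul_distrib, pow_mul, mul_assoc]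
  simp only [symbolMoment, h1]
  rw [h]
  refine Finset.sum_congr rfl fun κ _ => ?_
  simp [multinomialProb, monomialNormSq, norm_prod]

theorem isBoundedCompOp_powerSumFun_iff {n : ℕ} (hn : 1 ≤ n) {β : ℝ} (hβ : -1 < β)
    {α : Fin n → ℂ} (hα : ∀ j, α j ≠ 0) (hsum : ∑ j, ‖α j‖ = 1) :
    IsBoundedCompOp n β (diagonalMap n (powerSumFun n α)) ↔ (n : ℝ) / 2 ≤ β + 5 / 2 := by
  have : Nonempty (Fin n) := ⟨⟨0, hn⟩⟩
  have hv := (hasPowerOrder_discMoment hβ).comp_mul (by linarith) hn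
  have hq : HasPowerOrder (symbolMoment n β (powerSumFun n α))
      (-(((n : ℝ) - 1) / 2) - n * (β + 1)) := by
    have := hasPowerOrder_sum_multinomialProb_sq (p := fun j => ‖α j‖)
      (fun j => norm_pos_iff.2 (hα j)) hsum (by linarith) hv
    simpa only [← symbolMoment_powerSumFun hn hβ α, Fintype.card_fin] using this
  rw [isBoundedCompOp_diagonalMap_iff_le hn hβ (powerSumFun_differentiable n α)
    (powerSumFun_mapsTo hn hα hsum) (by omega) (fun c _ z => powerSumFun_homogeneous n α c z) hq]
  · constructor <;> intro h <;> linarith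
  · rintro rfl
    push_cast
    linarith

end

theorem mainTheorem9 (n : ℕ) (hn : 1 ≤ n) (β : ℝ) (hβ : -1 < β) :
    (IsBoundedCompOp n β (diagonalMap n (prodFun n)) ↔ (n : ℝ) ≤ β + 3) ∧
    ∀ α : Fin n → ℂ, (∀ j, α j ≠ 0) → ∑ j, ‖α j‖ = 1 →
      (IsBoundedCompOp n β (diagonalMap n (powerSumFun n α)) ↔ (n : ℝ) / 2 ≤ β + 5 / 2) :=
  ⟨isBoundedCompOp_prodFun_iff hn hβ, fun _ hα hsum => isBoundedCompOp_powerSumFun_iff hn hβ hα hsum⟩
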